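/- Let $N\ge 0$, let $g,f_0,\dots,f_N:\mathbb R\to\mathbb R$ be Lipschitz functions with $f_0,\dots,f_N$ linearly independent, and for $\theta=(a_0,\dots,a_N)\in\mathbb R^{N+1}$ put $\mu(x,\theta)=g(x)+\sum_{i=0}^N a_i f_i(x)$. Fix $\theta_0\in\mathbb R^{N+1}$, $\Delta>0$, an integer $M\ge 2$, $\delta=\Delta/M$ and $u_0,u_M\in\mathbb R$. Let $X$ be a solution of $dX_t=\mu(X_t,\theta_0)\,dt+dW_t$ with $X_0=u_0$, where $W$ is a standard Brownian motion, and let $\mathbb Q_{\theta_0}$ be the law of the bridge of $X$ from $u_0$ to $u_M$ over $[0,\Delta]$, that is, the conditional law of $(X_t)_{0\le t\le\Delta}$ given $X_\Delta=u_M$, in the version whose finite-dimensional distributions are weakly continuous in the endpoint. Let $U_m$ be the value at time $m\delta$ of the bridge, $0\le m\le M$ (so $U_0=u_0$ and $U_M=u_M$ almost surely), and let $\phi(\,\cdot\,;x,v)$ be the normal density with mean $x$ and variance $v$. Consider the approximate complete likelihood $$L(\theta)=\mathbb E_{\mathbb Q_{\theta_0}}\Big[\sum_{m=1}^M\log\phi\big(U_m;\,U_{m-1}+\delta\mu(U_{m-1},\theta),\,\delta\big)\Big],\qquad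 \theta\in\mathbb R^{N+1}.$$ Then: 1. All expectations here and in (3) are those of integrable random variables, and $L$ is a nondegenerate quadratic function of $\theta$: $L(\theta)=q(\theta)+\ell(\theta)+c$ with $q$ a nondegenerate quadratic form, $\ell$ a linear form and $c\in\mathbb R$. 2. $L$ has a unique global maximum point $\theta^*\in\mathbb R^{N+1}$. 3. Let $A=\delta\sum_{m=1}^M A_m$ and $b=\sum_{m=1}^M b_m$, where $(A_m)_{ji}=\mathbb E_{\mathbb Q_{\theta_0}}[f_i(U_{m-1})f_j(U_{m-1})]$ and $(b_m)_j=\mathbb E_{\mathbb Q_{\theta_0}}[(U_m-U_{m-1}-g(U_{m-1})\delta)f_j(U_{m-1})]$ for $0\le i,j\le N$. Then $A$ is invertible, and $\theta\in\mathbb R^{N+1}$ is a global maximum point of $L$ if and only if $A\theta=b$; that is, $\theta^*=A^{-1}b$. -/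

import Mathlib

open MeasureTheory ProbabilityTheory
open scoped NNReal BoundedContinuousFunction

noncomputable section

namespace DiffusionEM

/-- The drift `μ(x, θ) = g(x) + ∑ᵢ aᵢ fᵢ(x)`, where `θ = (a₀, …, a_N)`. -/
def drift {N : ℕ} (g : ℝ → ℝ) (f : Fin (N + 1) → ℝ → ℝ) (x : ℝ) (θ : Fin (N + 1) → ℝ) : ℝ :=
  g x + ∑ i, θ i * f i x

/-- `X` solves `dX_t = b(X_t) dt + dW_t`, `X_0 = x₀`, for some filtration and some Brownian motion
`W` of that filtration on the probability space `(Ω, P)`: a (weak) solution of the equation. -/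
def IsDiffusion {Ω : Type*} [mΩ : MeasurableSpace Ω] (P : Measure Ω) (b : ℝ → ℝ) (x₀ : ℝ)
    (X : ℝ≥0 → Ω → ℝ) : Prop :=
  ∃ (𝓕 : Filtration ℝ≥0 mΩ) (W : ℝ≥0 → Ω → ℝ),
    IsBrownianReal W P ∧
    Adapted 𝓕 W ∧
    (∀ s t : ℝ≥0, s ≤ t →
      Indep (MeasurableSpace.comap (fun ω => W t ω - W s ω) inferInstance) (𝓕 s) P) ∧
    Adapted 𝓕 X ∧
    (∀ᵐ ω ∂P, Continuous fun t => X t ω) ∧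
    (∀ᵐ ω ∂P, ∀ t : ℝ≥0,
      X t ω = x₀ + (∫ s in (0 : ℝ)..(t : ℝ), b (X s.toNNReal ω)) + W t ω)

/-- `Q y` is the law of the bridge of `X` over the time interval `[0, T]` with endpoint `y`, for
every `y`: it is the regular conditional distribution of the path `(X_t)_{t ≤ T}` given `X_T = y`,
in the version whose finite-dimensional distributions depend (weakly) continuously on `y`.
The continuity determines `Q y` for every `y`, and not only for almost every `y`, as soon as
the law of `X_T` charges all nonempty open sets. -/
structure IsBridgeKernel {Ω : Type*} [MeasurableSpace Ω] (P : Measure Ω) (X : ℝ≥0 → Ω → ℝ)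
    (T : ℝ≥0) (Q : Kernel ℝ (Set.Iic T → ℝ)) : Prop where
  isMarkov : IsMarkovKernel Q
  condDistrib : HasCondDistrib (fun ω (t : Set.Iic T) => X t ω) (X T) Q P
  continuous_fdd : ∀ (I : Finset (Set.Iic T)) (F : (I → ℝ) →ᵇ ℝ),
    Continuous fun y => ∫ w, F (I.restrict w) ∂(Q y)

/-- The step length `δ = T / M`. -/
def step (T : ℝ≥0) (M : ℕ) : ℝ≥0 := T / M

theorem mul_step_le (T : ℝ≥0) (M : ℕ) (m : Fin (M + 1)) : (m : ℝ≥0) * step T M ≤ T := by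
  rcases Nat.eq_zero_or_pos M with h | h
  · subst h
    simp [step]
  · have hM : (0 : ℝ≥0) < M := by exact_mod_cast h
    have hm : (m : ℝ≥0) ≤ M := by exact_mod_cast Nat.lt_succ_iff.mp m.2
    calc (m : ℝ≥0) * step T M ≤ M * (T / M) := mul_le_mul_left hm _
      _ = T := mul_div_cancel₀ T hM.ne'

/-- The state `U_m` at time `m δ` of a path on `[0, T]`, for `m = 0, …, M`. -/
def U {T : ℝ≥0} (M : ℕ) (m : Fin (M + 1)) (w : Set.Iic T → ℝ) : ℝ :=
  w ⟨m * step T M, mul_step_le T M m⟩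

/-- `∑_{m=1}^M log φ(U_m; U_{m-1} + δ μ(U_{m-1}, θ), δ)`, where `φ(·; x, v)` is the normal density
with mean `x` and variance `v`; the index `m : Fin M` stands for `m + 1 ∈ {1, …, M}`. -/
def logLik {N : ℕ} (g : ℝ → ℝ) (f : Fin (N + 1) → ℝ → ℝ) {T : ℝ≥0} (M : ℕ)
    (θ : Fin (N + 1) → ℝ) (w : Set.Iic T → ℝ) : ℝ :=
  ∑ m : Fin M, Real.log (gaussianPDFReal
    (U M m.castSucc w + step T M * drift g f (U M m.castSucc w) θ) (step T M) (U M m.succ w))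

/-- The approximate complete likelihood `θ ↦ E_Q[∑_m log φ(…)]`. -/
def completeLik {N : ℕ} (g : ℝ → ℝ) (f : Fin (N + 1) → ℝ → ℝ) {T : ℝ≥0} (M : ℕ)
    (Q : Measure (Set.Iic T → ℝ)) (θ : Fin (N + 1) → ℝ) : ℝ :=
  ∫ w, logLik g f M θ w ∂Q

/-- The matrix `A_{m+1}`, with entry `E_Q[f_i(U_m) f_j(U_m)]` in row `j` and column `i`. -/
def matA {N : ℕ} (f : Fin (N + 1) → ℝ → ℝ) {T : ℝ≥0} (M : ℕ)
    (Q : Measure (Set.Iic T → ℝ)) (m : Fin M) : Matrix (Fin (N + 1)) (Fin (N + 1)) ℝ :=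
  Matrix.of fun j i => ∫ w, f i (U M m.castSucc w) * f j (U M m.castSucc w) ∂Q

/-- The vector `b_{m+1}`, with entries `E_Q[(U_{m+1} - U_m - g(U_m) δ) f_j(U_m)]`. -/
def vecB {N : ℕ} (g : ℝ → ℝ) (f : Fin (N + 1) → ℝ → ℝ) {T : ℝ≥0} (M : ℕ)
    (Q : Measure (Set.Iic T → ℝ)) (m : Fin M) : Fin (N + 1) → ℝ :=
  fun j => ∫ w, (U M m.succ w - U M m.castSucc w - g (U M m.castSucc w) * step T M) *
    f j (U M m.castSucc w) ∂Q

/-- `A = δ ∑_{m=1}^M A_m`. -/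
def sysA {N : ℕ} (f : Fin (N + 1) → ℝ → ℝ) {T : ℝ≥0} (M : ℕ)
    (Q : Measure (Set.Iic T → ℝ)) : Matrix (Fin (N + 1)) (Fin (N + 1)) ℝ :=
  (step T M : ℝ) • ∑ m : Fin M, matA f M Q m

/-- `b = ∑_{m=1}^M b_m`. -/
def sysB {N : ℕ} (g : ℝ → ℝ) (f : Fin (N + 1) → ℝ → ℝ) {T : ℝ≥0} (M : ℕ)
    (Q : Measure (Set.Iic T → ℝ)) : Fin (N + 1) → ℝ :=
  ∑ m : Fin M, vecB g f M Q m

end DiffusionEM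

end

/-!
Expanding the Gaussian log-densities gives `L(θ) = c + b · θ - ½ θ · A θ`. All claims follow by
completing the square once the states `U_m` of the bridge are known to be square integrable (which
gives the integrability statements, as `g` and the `fᵢ` grow at most linearly) and `A` is known to
be positive definite. For the latter, `v · A v = δ ∑ₘ E[(∑ᵢ vᵢ fᵢ(U_m))²]`; since `M ≥ 2`, the sum
has a term with an interior time, and it suffices that the law of the bridge at an interior time
charges all nonempty open sets, because the `fᵢ` are continuous and linearly independent.

The two facts about the bridge come from two-sided bounds on the conditional law of `X_t` given the
past up to `s < t`: it has a density bounded by a constant (`IsEulerLimit.lintegral_mul_le`) and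
bounded below on bounded intervals by a positive random variable (`IsEulerLimit.le_lintegral_mul`).
Neither Girsanov's theorem nor heat kernel estimates are needed. As the noise is additive, the
equation can be solved path by path. Split the Brownian path into its increment `Z = W_t - W_s` and
the rest, in which the linear part of this increment has been removed; the two parts are
independent (`indepFun_sub_incrementCoeff`). With the rest fixed, `X_t` is an increasing
bi-Lipschitz function of `Z`, with constants that depend only on the Lipschitz constant of the drift
and on `t - s`, so its law has the density of a Gaussian up to these constants. The argument is
carried out for the Euler schemes (`euler_bilipschitz`), where everything is a measurable function
of finitely many values of the path, and passes to the limit in expectations of continuous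
functions.

For continuous `φ`, the function `y ↦ E_{Q y}[φ(U_m)]` is continuous, and its integral against
`k(y) P(X_T ∈ dy)` is `E[φ(X_s) k(X_T)]`. Letting `k` run through tent functions that concentrate
at the endpoint of interest, the two-sided bounds compare this function with constants at that very
endpoint: from above with `φ(x) = min(x², n)` for the second moment
(`IsBridgeKernel.exists_lintegral_le`), and from below for the support
(`IsBridgeKernel.lintegral_ne_zero`).
-/

namespace DiffusionEM

/-! ### The Euler scheme along a driving path -/

/-- The Euler scheme with step `h` for `dx = b(x) dt + dw`, started at `x₀`; the driving path is
given by its values `w k` at the grid points `k h`. -/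
def euler (b : ℝ → ℝ) (h x₀ : ℝ) (w : ℕ → ℝ) : ℕ → ℝ
  | 0 => x₀
  | k + 1 => euler b h x₀ w k + h * b (euler b h x₀ w k) + (w (k + 1) - w k)

theorem euler_congr {b : ℝ → ℝ} {h x₀ : ℝ} {w w' : ℕ → ℝ} {k : ℕ} (hw : ∀ i ≤ k, w i = w' i) :
    euler b h x₀ w k = euler b h x₀ w' k := by
  induction k with
  | zero => rfl
  | succ k ih =>
    simp only [euler]
    rw [ih fun i hi => hw i (by omega), hw (k + 1) le_rfl, hw k (by omega)]

theorem measurable_euler {α : Type*} [MeasurableSpace α] {b : ℝ → ℝ} (hb : Measurable b)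
    (h x₀ : ℝ) {w : α → ℕ → ℝ} (hw : Measurable w) (k : ℕ) :
    Measurable fun a => euler b h x₀ (w a) k := by
  induction k with
  | zero => exact measurable_const
  | succ k ih =>
    have h1 : ∀ i, Measurable fun a => w a i := fun i => (measurable_pi_apply i).comp hw
    simp only [euler]
    exact (ih.add ((hb.comp ih).const_mul h)).add ((h1 (k + 1)).sub (h1 k))

theorem abs_sub_le_of_lipschitz {b : ℝ → ℝ} {K : ℝ≥0} (hb : LipschitzWith K b) (x y : ℝ) :
    |b x - b y| ≤ K * |x - y| := by
  simpa [Real.dist_eq] using hb.dist_le_mul x y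

/-- The global error of the Euler scheme for a solution `x` that oscillates by at most `ε` within
each step: one step multiplies the error by at most `1 + K h` and adds at most `K h ε`. -/
theorem abs_sub_euler_le {b : ℝ → ℝ} {K : ℝ≥0} (hb : LipschitzWith K b) {x w : ℝ≥0 → ℝ} {x₀ : ℝ}
    (hx : Continuous x) (hw : w 0 = 0)
    (heq : ∀ t : ℝ≥0, x t = x₀ + (∫ s in (0 : ℝ)..t, b (x s.toNNReal)) + w t)
    (h : ℝ≥0) {ε : ℝ} (n : ℕ)
    (hosc : ∀ k < n, ∀ r : ℝ≥0, k * h ≤ r → r ≤ (k + 1) * h → |x r - x (k * h)| ≤ ε) :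
    ∀ k ≤ n, |x (k * h) - euler b h x₀ (fun i => w (i * h)) k|
      ≤ k * (K * h * ε) * (1 + K * h) ^ k := by
  intro k hk
  induction k with
  | zero => simp [euler, heq 0, hw]
  | succ k ih =>
    have ih := ih (by omega)
    set y := euler b h x₀ (fun i => w (i * h)) k with hy
    have hcont : Continuous fun s : ℝ => b (x s.toNNReal) :=
      hb.continuous.comp (hx.comp continuous_real_toNNReal)
    have hle : ((k * h : ℝ≥0) : ℝ) ≤ (((k + 1 : ℕ) * h : ℝ≥0) : ℝ) := by
      push_cast; nlinarith [h.2]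
    have hstep : x ((k + 1 : ℕ) * h) - euler b h x₀ (fun i => w (i * h)) (k + 1)
        = (x (k * h) - y) + ∫ s in ((k * h : ℝ≥0) : ℝ)..(((k + 1 : ℕ) * h : ℝ≥0) : ℝ),
          (b (x s.toNNReal) - b y) := by
      rw [intervalIntegral.integral_sub (hcont.intervalIntegrable _ _)
        (continuous_const.intervalIntegrable _ _),
        ← intervalIntegral.integral_interval_sub_left (hcont.intervalIntegrable 0 _)
          (hcont.intervalIntegrable 0 _), intervalIntegral.integral_const, euler, ← hy,
        heq ((k + 1 : ℕ) * h), heq (k * h)]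
      push_cast
      simp only [smul_eq_mul]
      ring
    have hint : |∫ s in ((k * h : ℝ≥0) : ℝ)..(((k + 1 : ℕ) * h : ℝ≥0) : ℝ),
        (b (x s.toNNReal) - b y)| ≤ K * (ε + |x (k * h) - y|) * h := by
      have := intervalIntegral.norm_integral_le_of_norm_le_const
        (a := ((k * h : ℝ≥0) : ℝ)) (b := (((k + 1 : ℕ) * h : ℝ≥0) : ℝ))
        (f := fun s => b (x s.toNNReal) - b y) (C := K * (ε + |x (k * h) - y|)) ?_
      · rw [Real.norm_eq_abs] at this
        refine this.trans (le_of_eq ?_)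
        push_cast
        rw [show ((k : ℝ) + 1) * h - k * h = h by ring, abs_of_nonneg h.coe_nonneg]
      · intro s hs
        rw [Set.uIoc_of_le hle] at hs
        have h0 : 0 ≤ s := (NNReal.coe_nonneg _).trans hs.1.le
        lift s to ℝ≥0 using h0
        rw [Real.toNNReal_coe, Real.norm_eq_abs]
        have h1 := hosc k (by omega) s (by exact_mod_cast hs.1.le) (by exact_mod_cast hs.2)
        refine (abs_sub_le_of_lipschitz hb _ _).trans ?_
        have h2 := abs_sub_le (x s) (x (k * h)) y
        exact mul_le_mul_of_nonneg_left (by linarith) K.2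
    rw [hstep]
    refine (abs_add_le _ _).trans ?_
    have hKh : (0 : ℝ) ≤ K * h := by positivity
    have hε : 0 ≤ ε := (abs_nonneg _).trans (hosc k (by omega) (k * h) le_rfl
      (mul_le_mul_left (by simp) _))
    have h1 : (1 : ℝ) ≤ (1 + K * h) ^ (k + 1) := one_le_pow₀ (by linarith)
    have h2 : 0 ≤ K * h * ε := by positivity
    calc |x (k * h) - y| + |_| ≤ (1 + K * h) * |x (k * h) - y| + K * h * ε * 1 := by linarith
      _ ≤ (1 + K * h) * (k * (K * h * ε) * (1 + K * h) ^ k)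
          + K * h * ε * (1 + K * h) ^ (k + 1) := by gcongr
      _ = _ := by push_cast; ring

theorem one_add_pow_le_exp {x : ℝ} (hx : 0 ≤ x) (n : ℕ) : (1 + x) ^ n ≤ Real.exp (n * x) := by
  rw [Real.exp_nat_mul]
  exact pow_le_pow_left₀ (by linarith) (by linarith [Real.add_one_le_exp x]) n

theorem exp_le_one_sub_pow {x : ℝ} (hx : 0 ≤ x) (hx' : x ≤ 1 / 2) (n : ℕ) :
    Real.exp (-(2 * (n * x))) ≤ (1 - x) ^ n := by
  rw [show -(2 * (n * x)) = n * (-(2 * x)) by ring, Real.exp_nat_mul]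
  refine pow_le_pow_left₀ (Real.exp_pos _).le ?_ n
  rw [Real.exp_neg]
  refine inv_le_of_inv_le₀ (by linarith) ?_
  rw [inv_le_iff_one_le_mul₀ (by linarith)]
  nlinarith [Real.add_one_le_exp (2 * x)]

/-- The Euler scheme of step `δ / (n + 1)` converges, at the time `j δ`, to the solution. -/
theorem tendsto_euler {b : ℝ → ℝ} {K : ℝ≥0} (hb : LipschitzWith K b) {x w : ℝ≥0 → ℝ} {x₀ : ℝ}
    (hx : Continuous x) (hw : w 0 = 0)
    (heq : ∀ t : ℝ≥0, x t = x₀ + (∫ s in (0 : ℝ)..t, b (x s.toNNReal)) + w t)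
    (δ : ℝ≥0) (j : ℕ) :
    Filter.Tendsto (fun n : ℕ => euler b (δ / (n + 1 : ℝ≥0) : ℝ≥0) x₀
      (fun i => w (i * (δ / (n + 1 : ℝ≥0)))) (j * (n + 1))) Filter.atTop (nhds (x (j * δ))) := by
  rw [Metric.tendsto_atTop]
  intro η hη
  set C : ℝ := j * δ * K * Real.exp (K * (j * δ)) with hC
  have hC0 : 0 ≤ C := by positivity
  have huc := (isCompact_Icc (a := (0 : ℝ≥0)) (b := j * δ)).uniformContinuousOn_of_continuous
    hx.continuousOn
  rw [Metric.uniformContinuousOn_iff] at huc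
  obtain ⟨d, hd, hosc⟩ := huc (η / (C + 1)) (by positivity)
  obtain ⟨n₀, hn₀⟩ := exists_nat_gt ((δ : ℝ) / d)
  refine ⟨n₀, fun n hn => ?_⟩
  set h : ℝ≥0 := δ / (n + 1 : ℝ≥0) with hh
  have hnh : (n + 1 : ℝ≥0) * h = δ := mul_div_cancel₀ _ (by positivity)
  have hhd : (h : ℝ) < d := by
    rw [hh]
    push_cast
    rw [div_lt_iff₀ (by positivity)]
    rw [div_lt_iff₀ hd] at hn₀
    have : (n₀ : ℝ) ≤ n := by exact_mod_cast hn
    nlinarith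
  have hNh : ((j * (n + 1) : ℕ) : ℝ≥0) * h = j * δ := by
    push_cast; rw [mul_assoc, hnh]
  have hmain := abs_sub_euler_le hb hx hw heq h (ε := η / (C + 1)) (j * (n + 1)) ?_
    (j * (n + 1)) le_rfl
  · rw [hNh] at hmain
    rw [dist_comm, Real.dist_eq]
    refine lt_of_le_of_lt hmain ?_
    have hpow := one_add_pow_le_exp (x := K * h) (by positivity) (j * (n + 1))
    have hNh' : ((j * (n + 1) : ℕ) : ℝ) * h = j * δ := by exact_mod_cast congrArg NNReal.toReal hNh
    rw [show ((j * (n + 1) : ℕ) : ℝ) * (K * h) = K * (j * δ) by rw [← hNh']; ring] at hpow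
    calc _ ≤ ((j * (n + 1) : ℕ) : ℝ) * (K * h * (η / (C + 1))) * Real.exp (K * (j * δ)) := by
          gcongr
      _ = C * η / (C + 1) := by
          rw [hC, ← hNh']; ring
      _ < η := by
          rw [div_lt_iff₀ (by positivity)]; nlinarith
  · intro k hk r hr1 hr2
    have hle : ((k : ℝ≥0) + 1) * h ≤ j * δ := by
      rw [← hNh]
      gcongr
      exact_mod_cast hk
    have h1 := hosc r ⟨zero_le, hr2.trans hle⟩ (k * h)
      ⟨zero_le, (mul_le_mul_left (by simp) _).trans hle⟩ ?_
    · rw [Real.dist_eq] at h1; exact h1.le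
    · rw [NNReal.dist_eq]
      have e1 : ((k * h : ℝ≥0) : ℝ) ≤ r := by exact_mod_cast hr1
      have e2 : (r : ℝ) ≤ (k + 1) * h := by exact_mod_cast hr2
      push_cast at e1 ⊢
      rw [abs_of_nonneg (by linarith)]
      linarith

/-- If the driving path is `r + z l`, where `l` vanishes up to the index `i` and increases by
`1 / n` in each of the `n` steps that follow, then the Euler scheme at the index `i + n` is a
bi-Lipschitz increasing function of `z`. -/
theorem euler_bilipschitz {b : ℝ → ℝ} {K : ℝ≥0} (hb : LipschitzWith K b) {h : ℝ≥0}
    (hKh : (K * h : ℝ) ≤ 1 / 2) (x₀ : ℝ) (r l : ℕ → ℝ) (i n : ℕ) (hn : 0 < n)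
    (hl : ∀ k ≤ i, l k = 0) (hl' : ∀ k < n, l (i + k + 1) - l (i + k) = 1 / n)
    {z z' : ℝ} (hz : z ≤ z') :
    Real.exp (-(2 * (n * (K * h)))) * (z' - z)
        ≤ euler b h x₀ (fun k => r k + l k * z') (i + n)
          - euler b h x₀ (fun k => r k + l k * z) (i + n) ∧
    euler b h x₀ (fun k => r k + l k * z') (i + n)
      - euler b h x₀ (fun k => r k + l k * z) (i + n)
        ≤ Real.exp (n * (K * h)) * (z' - z) := by
  have hKh0 : (0 : ℝ) ≤ K * h := by positivity
  have hd : 0 ≤ z' - z := by linarith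
  have hn' : (0 : ℝ) < n := by exact_mod_cast hn
  have key : ∀ k ≤ n, (1 - K * h) ^ k * (k / n * (z' - z))
        ≤ euler b h x₀ (fun k => r k + l k * z') (i + k)
          - euler b h x₀ (fun k => r k + l k * z) (i + k) ∧
      euler b h x₀ (fun k => r k + l k * z') (i + k)
        - euler b h x₀ (fun k => r k + l k * z) (i + k)
        ≤ (1 + K * h) ^ k * (k / n * (z' - z)) := by
    intro k hk
    induction k with
    | zero =>
      have : euler b h x₀ (fun k => r k + l k * z') (i + 0)
          = euler b h x₀ (fun k => r k + l k * z) (i + 0) :=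
        euler_congr fun m hm => by simp [hl m hm]
      rw [this]
      simp
    | succ k ih =>
      obtain ⟨ih1, ih2⟩ := ih (by omega)
      rw [← add_assoc]
      simp only [euler]
      set y' := euler b h x₀ (fun k => r k + l k * z') (i + k)
      set y := euler b h x₀ (fun k => r k + l k * z) (i + k)
      have hinc : r (i + k + 1) + l (i + k + 1) * z' - (r (i + k) + l (i + k) * z')
          - (r (i + k + 1) + l (i + k + 1) * z - (r (i + k) + l (i + k) * z))
          = 1 / n * (z' - z) := by
        rw [← hl' k (by omega)]; ring
      have hy : 0 ≤ y' - y := le_trans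
        (mul_nonneg (pow_nonneg (by linarith) _) (by positivity)) ih1
      have hbb := abs_le.1 (abs_sub_le_of_lipschitz hb y' y)
      rw [abs_of_nonneg hy] at hbb
      have hb1 := mul_le_mul_of_nonneg_left hbb.1 h.2
      have hb2 := mul_le_mul_of_nonneg_left hbb.2 h.2
      have hp1 : (1 - K * h : ℝ) ^ (k + 1) ≤ 1 := pow_le_one₀ (by linarith) (by linarith)
      have hp2 : (1 : ℝ) ≤ (1 + K * h) ^ (k + 1) := one_le_pow₀ (by linarith)
      have hnz : 0 ≤ 1 / n * (z' - z) := by positivity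
      have hm1 := mul_le_mul_of_nonneg_right hp1 hnz
      have hm2 := mul_le_mul_of_nonneg_right hp2 hnz
      have hq1 := mul_le_mul_of_nonneg_left ih1 (show (0 : ℝ) ≤ 1 - K * h by linarith)
      have hq2 := mul_le_mul_of_nonneg_left ih2 (show (0 : ℝ) ≤ 1 + K * h by linarith)
      have e1 : (1 - K * h : ℝ) ^ (k + 1) * (((k + 1 : ℕ) : ℝ) / n * (z' - z))
          = (1 - K * h) * ((1 - K * h) ^ k * (k / n * (z' - z)))
            + (1 - K * h) ^ (k + 1) * (1 / n * (z' - z)) := by push_cast; ring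
      have e2 : (1 + K * h : ℝ) ^ (k + 1) * (((k + 1 : ℕ) : ℝ) / n * (z' - z))
          = (1 + K * h) * ((1 + K * h) ^ k * (k / n * (z' - z)))
            + (1 + K * h) ^ (k + 1) * (1 / n * (z' - z)) := by push_cast; ring
      rw [e1, e2]
      simp only [NNReal.val_eq_coe] at hb1 hb2
      constructor <;> nlinarith
  obtain ⟨k1, k2⟩ := key n le_rfl
  rw [div_self hn'.ne', one_mul] at k1 k2
  exact ⟨(mul_le_mul_of_nonneg_right (exp_le_one_sub_pow hKh0 hKh n) hd).trans k1,
    k2.trans (mul_le_mul_of_nonneg_right (one_add_pow_le_exp hKh0 n) hd)⟩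

/-! ### Bi-Lipschitz changes of variable on the line -/

section Bilipschitz

variable {ψ : ℝ → ℝ} {a c : ℝ≥0}

theorem abs_sub_le_of_bilipschitz
    (hψ : ∀ z z', z ≤ z' → a * (z' - z) ≤ ψ z' - ψ z ∧ ψ z' - ψ z ≤ c * (z' - z)) (z z' : ℝ) :
    a * |z' - z| ≤ |ψ z' - ψ z| ∧ |ψ z' - ψ z| ≤ c * |z' - z| := by
  wlog h : z ≤ z' generalizing z z'
  · rw [abs_sub_comm z', abs_sub_comm (ψ z')]
    exact this z' z (le_of_not_ge h)
  have h1 := hψ z z' h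
  rw [abs_of_nonneg (by linarith : 0 ≤ z' - z), abs_of_nonneg]
  · exact h1
  · exact (mul_nonneg a.2 (by linarith)).trans h1.1

theorem lipschitzWith_of_bilipschitz
    (hψ : ∀ z z', z ≤ z' → a * (z' - z) ≤ ψ z' - ψ z ∧ ψ z' - ψ z ≤ c * (z' - z)) :
    LipschitzWith c ψ :=
  LipschitzWith.of_dist_le_mul fun x y => by
    simpa [Real.dist_eq] using (abs_sub_le_of_bilipschitz hψ y x).2

theorem surjective_of_bilipschitz (ha : 0 < a)
    (hψ : ∀ z z', z ≤ z' → a * (z' - z) ≤ ψ z' - ψ z ∧ ψ z' - ψ z ≤ c * (z' - z)) :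
    Function.Surjective ψ := by
  have ha' : (0 : ℝ) < a := ha
  refine (lipschitzWith_of_bilipschitz hψ).continuous.surjective ?_ ?_
  · refine Filter.tendsto_atTop_mono' _ (f₁ := fun z => ψ 0 + a * z) ?_ ?_
    · filter_upwards [Filter.eventually_ge_atTop 0] with z hz
      have := (hψ 0 z hz).1
      linarith
    · exact Filter.tendsto_atTop_add_const_left _ _ (Filter.tendsto_id.const_mul_atTop ha')
  · refine Filter.tendsto_atBot_mono' _ (f₁ := fun z => ψ 0 + a * z) ?_ ?_
    · filter_upwards [Filter.eventually_le_atBot 0] with z hz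
      have := (hψ z 0 hz).1
      linarith
    · exact Filter.tendsto_atBot_add_const_left _ _ (Filter.tendsto_id.const_mul_atBot ha')

theorem mul_volume_preimage_le (ha : 0 < a)
    (hψ : ∀ z z', z ≤ z' → a * (z' - z) ≤ ψ z' - ψ z ∧ ψ z' - ψ z ≤ c * (z' - z)) (s : Set ℝ) :
    volume (ψ ⁻¹' s) ≤ (a⁻¹ : ℝ≥0) * volume s := by
  have h : AntilipschitzWith a⁻¹ ψ := AntilipschitzWith.of_le_mul_dist fun x y => by
    have := (abs_sub_le_of_bilipschitz hψ y x).1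
    rw [Real.dist_eq, Real.dist_eq, NNReal.coe_inv, inv_mul_eq_div, le_div_iff₀ (by exact_mod_cast ha)]
    linarith
  simpa [hausdorffMeasure_real] using h.hausdorffMeasure_preimage_le zero_le_one s

theorem volume_le_mul_volume_preimage (ha : 0 < a)
    (hψ : ∀ z z', z ≤ z' → a * (z' - z) ≤ ψ z' - ψ z ∧ ψ z' - ψ z ≤ c * (z' - z)) (s : Set ℝ) :
    volume s ≤ c * volume (ψ ⁻¹' s) := by
  have h := ((lipschitzWith_of_bilipschitz hψ).lipschitzOnWith (s := ψ ⁻¹' s)).hausdorffMeasure_image_le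
    zero_le_one
  rw [Set.image_preimage_eq _ (surjective_of_bilipschitz ha hψ)] at h
  simpa [hausdorffMeasure_real] using h

theorem lintegral_comp_le_of_bilipschitz (ha : 0 < a)
    (hψ : ∀ z z', z ≤ z' → a * (z' - z) ≤ ψ z' - ψ z ∧ ψ z' - ψ z ≤ c * (z' - z))
    {k : ℝ → ENNReal} (hk : Measurable k) :
    ∫⁻ z, k (ψ z) ≤ (a⁻¹ : ℝ≥0) * ∫⁻ y, k y := by
  have hm := (lipschitzWith_of_bilipschitz hψ).continuous.measurable
  have hle : Measure.map ψ volume ≤ (a⁻¹ : ℝ≥0) • (volume : Measure ℝ) := by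
    refine Measure.le_iff.2 fun s hs => ?_
    rw [Measure.map_apply hm hs]
    exact mul_volume_preimage_le ha hψ s
  rw [← lintegral_map hk hm]
  refine (lintegral_mono' hle le_rfl).trans (le_of_eq ?_)
  rw [lintegral_smul_measure]; rfl

theorem lintegral_le_of_bilipschitz (ha : 0 < a)
    (hψ : ∀ z z', z ≤ z' → a * (z' - z) ≤ ψ z' - ψ z ∧ ψ z' - ψ z ≤ c * (z' - z))
    {k : ℝ → ENNReal} (hk : Measurable k) :
    ∫⁻ y, k y ≤ c * ∫⁻ z, k (ψ z) := by
  have hm := (lipschitzWith_of_bilipschitz hψ).continuous.measurable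
  have hle : (volume : Measure ℝ) ≤ c • Measure.map ψ volume := by
    refine Measure.le_iff.2 fun s hs => ?_
    rw [Measure.smul_apply, Measure.map_apply hm hs]
    exact volume_le_mul_volume_preimage ha hψ s
  rw [← lintegral_map hk hm]
  refine (lintegral_mono' hle le_rfl).trans (le_of_eq ?_)
  rw [lintegral_smul_measure]; rfl

end Bilipschitz

/-! ### Gaussian integrals after a bi-Lipschitz change of variable -/

theorem gaussianPDFReal_le (v : ℝ≥0) (x : ℝ) :
    gaussianPDFReal 0 v x ≤ (√(2 * Real.pi * v))⁻¹ := by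
  rw [gaussianPDFReal]
  refine mul_le_of_le_one_right (by positivity) (Real.exp_le_one_iff.2 ?_)
  exact div_nonpos_of_nonpos_of_nonneg (by nlinarith [sq_nonneg (x - 0)]) (by positivity)

theorem gaussianPDFReal_le_of_abs_le (v : ℝ≥0) {x y : ℝ} (h : |x| ≤ |y|) :
    gaussianPDFReal 0 v y ≤ gaussianPDFReal 0 v x := by
  simp only [gaussianPDFReal, sub_zero]
  have := sq_le_sq.2 h
  gcongr

theorem continuous_gaussianPDF (v : ℝ≥0) : Continuous (gaussianPDF 0 v) := by
  refine ENNReal.continuous_ofReal.comp ?_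
  unfold gaussianPDFReal
  fun_prop

theorem gaussianPDF_le_coe (v : ℝ≥0) (x : ℝ) :
    gaussianPDF 0 v x ≤ ((√(2 * Real.pi * v))⁻¹.toNNReal : ℝ≥0) :=
  ENNReal.ofReal_le_ofReal (gaussianPDFReal_le v x)

section Bilipschitz

variable {ψ : ℝ → ℝ} {a c v : ℝ≥0}

/-- The image of a Gaussian law under a bi-Lipschitz map has a bounded density. -/
theorem lintegral_gaussian_comp_le (hv : v ≠ 0) (ha : 0 < a)
    (hψ : ∀ z z', z ≤ z' → a * (z' - z) ≤ ψ z' - ψ z ∧ ψ z' - ψ z ≤ c * (z' - z))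
    {k : ℝ → ENNReal} (hk : Measurable k) :
    ∫⁻ z, k (ψ z) ∂(gaussianReal 0 v) ≤
      ((√(2 * Real.pi * v))⁻¹.toNNReal * a⁻¹ : ℝ≥0) * ∫⁻ y, k y := by
  have hm := (lipschitzWith_of_bilipschitz hψ).continuous.measurable
  have hkψ : Measurable fun z => k (ψ z) := hk.comp hm
  rw [gaussianReal_of_var_ne_zero 0 hv,
    lintegral_withDensity_eq_lintegral_mul _ (measurable_gaussianPDF 0 v) hkψ]
  calc _ ≤ ∫⁻ z, ((√(2 * Real.pi * v))⁻¹.toNNReal : ℝ≥0) * k (ψ z) :=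
        lintegral_mono fun z => mul_le_mul_left (gaussianPDF_le_coe v z) _
    _ = ((√(2 * Real.pi * v))⁻¹.toNNReal : ℝ≥0) * ∫⁻ z, k (ψ z) :=
        lintegral_const_mul _ (hk.comp hm)
    _ ≤ _ := by
        refine (mul_le_mul_right (lintegral_comp_le_of_bilipschitz ha hψ hk) _).trans_eq ?_
        rw [ENNReal.coe_mul]
        ring

/-- The image of a Gaussian law under a bi-Lipschitz map `ψ` has a density on `[-R, R]` that is
bounded below in terms of `|ψ 0|`. -/
theorem le_lintegral_gaussian_comp (hv : v ≠ 0) (ha : 0 < a)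
    (hψ : ∀ z z', z ≤ z' → a * (z' - z) ≤ ψ z' - ψ z ∧ ψ z' - ψ z ≤ c * (z' - z))
    {k : ℝ → ENNReal} (hk : Measurable k) {R : ℝ} (hR : ∀ x, R < |x| → k x = 0) :
    gaussianPDF 0 v ((a : ℝ)⁻¹ * (R + |ψ 0|)) * ∫⁻ y, k y ≤
      c * ∫⁻ z, k (ψ z) ∂(gaussianReal 0 v) := by
  have hm := (lipschitzWith_of_bilipschitz hψ).continuous.measurable
  have ha' : (0 : ℝ) < a := ha
  have hkψ : Measurable fun z => k (ψ z) := hk.comp hm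
  rw [gaussianReal_of_var_ne_zero 0 hv,
    lintegral_withDensity_eq_lintegral_mul _ (measurable_gaussianPDF 0 v) hkψ]
  have h1 : ∀ z, gaussianPDF 0 v ((a : ℝ)⁻¹ * (R + |ψ 0|)) * k (ψ z)
      ≤ gaussianPDF 0 v z * k (ψ z) := by
    intro z
    by_cases hz : R < |ψ z|
    · simp [hR _ hz]
    · refine mul_le_mul_left (ENNReal.ofReal_le_ofReal (gaussianPDFReal_le_of_abs_le v ?_)) _
      have h2 := (abs_sub_le_of_bilipschitz hψ 0 z).1
      have h3 := abs_sub (ψ z) (ψ 0)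
      rw [sub_zero] at h2
      push Not at hz
      refine le_trans ?_ (le_abs_self _)
      rw [inv_mul_eq_div, le_div_iff₀ ha']
      linarith
  calc _ ≤ gaussianPDF 0 v ((a : ℝ)⁻¹ * (R + |ψ 0|)) * (c * ∫⁻ z, k (ψ z)) :=
        mul_le_mul_right (lintegral_le_of_bilipschitz ha hψ hk) _
    _ = c * ∫⁻ z, gaussianPDF 0 v ((a : ℝ)⁻¹ * (R + |ψ 0|)) * k (ψ z) := by
        rw [lintegral_const_mul _ hkψ]
        ring
    _ ≤ _ := mul_le_mul_right (lintegral_mono h1) _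

end Bilipschitz

/-! ### Splitting off the increment of Brownian motion over an interval -/

variable {Ω : Type*} [MeasurableSpace Ω] {P : Measure Ω} {W : ℝ≥0 → Ω → ℝ}

/-- The coefficient of the regression of `W_u` on `W_t - W_s`, for a Brownian motion `W`: it is
`0` before `s` and `1` after `t`, and affine in between. -/
noncomputable def incrementCoeff (s t u : ℝ≥0) : ℝ := ((min u t : ℝ≥0) - (min u s : ℝ≥0) : ℝ) / (t - s)

/-- The path of a Brownian motion, with the linear part of its increment over `[s, t]` removed, is
independent of this increment. -/
theorem indepFun_sub_incrementCoeff (hW : IsPreBrownianReal W P) {s t : ℝ≥0} (hst : s < t) :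
    IndepFun (fun ω u => W u ω - incrementCoeff s t u * (W t ω - W s ω))
      (fun ω => W t ω - W s ω) P := by
  have hP := hW.isGaussianProcess.isProbabilityMeasure
  have mW t := hW.aemeasurable t
  have hL t := (hW.isGaussianProcess.hasGaussianLaw_eval t).memLp_two
  have hst' : ((t : ℝ) - s) ≠ 0 := sub_ne_zero.2 (by exact_mod_cast hst.ne')
  have key : IndepFun (fun ω u => W u ω - incrementCoeff s t u * (W t ω - W s ω))
      (fun ω (_ : Unit) => W t ω - W s ω) P := by
    refine IsGaussianProcess.indepFun_of_covariance_eq_zero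
      (X := fun u ω => W u ω - incrementCoeff s t u * (W t ω - W s ω))
      (Y := fun (_ : Unit) ω => W t ω - W s ω) ?_ (by fun_prop) (by fun_prop) ?_
    · apply hW.isGaussianProcess.of_isGaussianProcess
      classical
      rintro (u | _)
      · exact ⟨{u, s, t},
          { toFun x := x ⟨u, by simp⟩ - incrementCoeff s t u * (x ⟨t, by simp⟩ - x ⟨s, by simp⟩)
            map_add' x y := by simp; ring
            map_smul' c x := by simp; ring }, by simp⟩
      · exact ⟨{s, t},
          { toFun x := x ⟨t, by simp⟩ - x ⟨s, by simp⟩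
            map_add' x y := by simp; ring
            map_smul' c x := by simp; ring }, by simp⟩
    · intro u _
      have hZ : MemLp (fun ω => W t ω - W s ω) 2 P := (hL t).sub (hL s)
      have hmin : min s t = s := min_eq_left hst.le
      have hmin' : min t s = s := min_eq_right hst.le
      rw [covariance_fun_sub_left (hL u) (hZ.const_mul _) hZ, covariance_const_mul_left,
        covariance_fun_sub_right (hL u) (hL t) (hL s),
        covariance_fun_sub_left (hL t) (hL s) hZ,
        covariance_fun_sub_right (hL t) (hL t) (hL s),
        covariance_fun_sub_right (hL s) (hL t) (hL s)]
      change cov[W u, W t; P] - cov[W u, W s; P] - incrementCoeff s t u *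
        (cov[W t, W t; P] - cov[W t, W s; P] - (cov[W s, W t; P] - cov[W s, W s; P])) = 0
      simp only [hW.covariance_eval, hmin, hmin', min_self, incrementCoeff, sub_self, sub_zero]
      push_cast
      field_simp
      ring
  exact key.comp (φ := id) (ψ := fun f : Unit → ℝ => f ()) measurable_id (measurable_pi_apply ())

theorem incrementCoeff_of_le {s t u : ℝ≥0} (hst : s ≤ t) (hu : u ≤ s) : incrementCoeff s t u = 0 := by
  simp [incrementCoeff, min_eq_left hu, min_eq_left (hu.trans hst)]

theorem incrementCoeff_of_mem {s t u : ℝ≥0} (hsu : s ≤ u) (hut : u ≤ t) :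
    incrementCoeff s t u = (u - s) / (t - s) := by
  simp [incrementCoeff, min_eq_right hsu, min_eq_left hut]

theorem hasLaw_increment (hW : IsPreBrownianReal W P) {s t τ : ℝ≥0} (hst : s + τ = t) :
    P.map (fun ω => W t ω - W s ω) = gaussianReal 0 τ := by
  have h := (hW.hasLaw_sub t s).map_eq
  have : nndist (t : ℝ) (s : ℝ) = τ := by
    apply NNReal.coe_injective
    rw [coe_nndist, Real.dist_eq, ← hst]
    push_cast
    rw [add_sub_cancel_left, abs_of_nonneg τ.coe_nonneg]
  simp only [NNReal.val_eq_coe, this] at h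
  exact h

/-! ### Two-sided estimates for the Euler scheme -/

/-- The Euler scheme with step `h` driven by the path `w`, as a function of the grid index. -/
def eulerPath (b : ℝ → ℝ) (h : ℝ≥0) (x₀ : ℝ) (w : ℝ≥0 → ℝ) (k : ℕ) : ℝ :=
  euler b h x₀ (fun i => w (i * h)) k

/-- Lower bi-Lipschitz constant of the Euler scheme over a time interval of length `τ`. -/
noncomputable def lowConst (K τ : ℝ≥0) : ℝ≥0 := (Real.exp (-(2 * (K * τ)))).toNNReal

/-- Upper bi-Lipschitz constant of the Euler scheme over a time interval of length `τ`. -/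
noncomputable def upConst (K τ : ℝ≥0) : ℝ≥0 := (Real.exp (K * τ)).toNNReal

theorem lowConst_pos (K τ : ℝ≥0) : 0 < lowConst K τ := Real.toNNReal_pos.2 (Real.exp_pos _)

theorem upConst_pos (K τ : ℝ≥0) : 0 < upConst K τ := Real.toNNReal_pos.2 (Real.exp_pos _)

section EulerEstimates

variable {b : ℝ → ℝ} {K : ℝ≥0} {h : ℝ≥0} {x₀ : ℝ}

theorem measurable_eulerPath (hb : LipschitzWith K b) (mW : ∀ t, Measurable (W t)) (k : ℕ) :
    Measurable fun ω => eulerPath b h x₀ (fun u => W u ω) k :=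
  measurable_euler hb.continuous.measurable _ _ (measurable_pi_lambda _ fun _ => mW _) k

/-- The value of the Euler scheme at the index `i + n` as a function of the increment `z` of the
driving path over the last `n` steps, the rest `r` of the driving path being fixed. -/
theorem eulerPath_bilipschitz (hb : LipschitzWith K b) (hKh : (K * h : ℝ) ≤ 1 / 2) (hh : h ≠ 0)
    (r : ℝ≥0 → ℝ) (i n : ℕ) (hn : 0 < n) {z z' : ℝ} (hz : z ≤ z') :
    lowConst K (n * h) * (z' - z) ≤
      eulerPath b h x₀ (fun u => r u + incrementCoeff (i * h) ((i + n : ℕ) * h) u * z') (i + n)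
      - eulerPath b h x₀ (fun u => r u + incrementCoeff (i * h) ((i + n : ℕ) * h) u * z) (i + n) ∧
    eulerPath b h x₀ (fun u => r u + incrementCoeff (i * h) ((i + n : ℕ) * h) u * z') (i + n)
      - eulerPath b h x₀ (fun u => r u + incrementCoeff (i * h) ((i + n : ℕ) * h) u * z) (i + n)
      ≤ upConst K (n * h) * (z' - z) := by
  have hh' : (h : ℝ) ≠ 0 := by exact_mod_cast hh
  have hn' : (n : ℝ) ≠ 0 := by exact_mod_cast hn.ne'
  have hval : ∀ k ≤ n, incrementCoeff (i * h) ((i + n : ℕ) * h) ((i + k : ℕ) * h) = k / n := by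
    intro k hk
    rw [incrementCoeff_of_mem (by gcongr; simp) (by gcongr)]
    push_cast
    rw [show ((i : ℝ) + k) * h - i * h = k * h by ring,
      show ((i : ℝ) + n) * h - i * h = n * h by ring, mul_div_mul_right _ _ hh']
  have := euler_bilipschitz hb hKh x₀ (fun k => r (k * h))
    (fun k => incrementCoeff (i * h) ((i + n : ℕ) * h) (k * h)) i n hn ?_ ?_ hz
  · rw [lowConst, upConst, Real.coe_toNNReal _ (Real.exp_pos _).le,
      Real.coe_toNNReal _ (Real.exp_pos _).le]
    push_cast
    rw [show (K * (n * h) : ℝ) = n * (K * h) by ring]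
    exact_mod_cast this
  · intro k hk
    exact incrementCoeff_of_le (by gcongr; simp) (by gcongr)
  · intro k hk
    rw [add_assoc i k 1, hval (k + 1) hk, hval k hk.le]
    push_cast
    ring

/-- Integrating out the increment of the Brownian motion over `[i h, (i + n) h]`, which is
independent of the rest of the path, in an expectation of the Euler scheme. -/
theorem lintegral_eulerPath_eq (hb : LipschitzWith K b) (hW : IsPreBrownianReal W P)
    (mW : ∀ t, Measurable (W t)) (hh : h ≠ 0) (i n : ℕ) (hn : 0 < n)
    {φ k : ℝ → ENNReal} (hφ : Measurable φ) (hk : Measurable k) :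
    ∫⁻ ω, φ (eulerPath b h x₀ (fun u => W u ω) i) *
        k (eulerPath b h x₀ (fun u => W u ω) (i + n)) ∂P =
      ∫⁻ ω, φ (eulerPath b h x₀ (fun u => W u ω) i) *
        ∫⁻ z, k (eulerPath b h x₀ (fun u =>
          (W u ω - incrementCoeff (i * h) ((i + n : ℕ) * h) u *
            (W ((i + n : ℕ) * h) ω - W (i * h) ω))
          + incrementCoeff (i * h) ((i + n : ℕ) * h) u * z) (i + n)) ∂(gaussianReal 0 (n * h)) ∂P := by
  have hP := hW.isGaussianProcess.isProbabilityMeasure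
  set s : ℝ≥0 := i * h with hs
  set t : ℝ≥0 := (i + n : ℕ) * h with ht
  have hst' : s + n * h = t := by rw [hs, ht]; push_cast; ring
  have hst : s < t := by
    rw [← hst']
    exact lt_add_of_pos_right _ (by positivity)
  set Rr : Ω → ℝ≥0 → ℝ := fun ω u => W u ω - incrementCoeff s t u * (W t ω - W s ω) with hRr
  set Z : Ω → ℝ := fun ω => W t ω - W s ω with hZ
  have mZ : Measurable Z := (mW t).sub (mW s)
  have mR : Measurable Rr := measurable_pi_lambda _ fun u => (mW u).sub (mZ.const_mul _)
  have hind : IndepFun Rr Z P := indepFun_sub_incrementCoeff hW hst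
  have hmap := (indepFun_iff_map_prod_eq_prod_map_map mR.aemeasurable mZ.aemeasurable).1 hind
  rw [hasLaw_increment hW hst'] at hmap
  have mY : ∀ k, Measurable fun p : (ℝ≥0 → ℝ) × ℝ =>
      eulerPath b h x₀ (fun u => p.1 u + incrementCoeff s t u * p.2) k := fun k =>
    measurable_euler hb.continuous.measurable _ _ (measurable_pi_lambda _ fun _ =>
      ((measurable_pi_apply _).comp measurable_fst).add (measurable_snd.const_mul _)) k
  set F : (ℝ≥0 → ℝ) × ℝ → ENNReal := fun p =>
    φ (eulerPath b h x₀ (fun u => p.1 u + incrementCoeff s t u * p.2) i) *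
      k (eulerPath b h x₀ (fun u => p.1 u + incrementCoeff s t u * p.2) (i + n)) with hF
  have mF : Measurable F := (hφ.comp (mY i)).mul (hk.comp (mY (i + n)))
  have hrec : ∀ ω, (fun u => Rr ω u + incrementCoeff s t u * Z ω) = fun u => W u ω := by
    intro ω; funext u; simp [hRr, hZ]
  have hpast : ∀ ω z, eulerPath b h x₀ (fun u => Rr ω u + incrementCoeff s t u * z) i
      = eulerPath b h x₀ (fun u => W u ω) i := fun ω z => by
    refine euler_congr fun m hm => ?_
    have : incrementCoeff s t (m * h) = 0 :=
      incrementCoeff_of_le hst.le (by rw [hs]; gcongr)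
    simp [hRr, this]
  calc _ = ∫⁻ ω, F (Rr ω, Z ω) ∂P := by
        refine lintegral_congr fun ω => ?_
        simp only [hF, hrec]
    _ = ∫⁻ p, F p ∂((P.map Rr).prod (gaussianReal 0 (n * h))) := by
        rw [← hmap, lintegral_map mF (mR.prodMk mZ)]
    _ = ∫⁻ ω, ∫⁻ z, F (Rr ω, z) ∂(gaussianReal 0 (n * h)) ∂P := by
        have := Measure.isProbabilityMeasure_map (μ := P) mR.aemeasurable
        rw [lintegral_prod _ mF.aemeasurable, lintegral_map mF.lintegral_prod_right' mR]
    _ = _ := by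
        refine lintegral_congr fun ω => ?_
        simp only [hF, hpast]
        rw [lintegral_const_mul]
        exact hk.comp ((mY (i + n)).comp (measurable_prodMk_left (x := Rr ω)))

/-- Given its past up to the index `i`, the Euler scheme at the index `i + n` has a density that is
bounded by a constant depending on the step and on `n` only through `n h`. -/
theorem lintegral_eulerPath_le (hb : LipschitzWith K b) (hW : IsPreBrownianReal W P)
    (mW : ∀ t, Measurable (W t)) (hh : h ≠ 0) (hKh : (K * h : ℝ) ≤ 1 / 2) (i n : ℕ) (hn : 0 < n)
    {φ k : ℝ → ENNReal} (hφ : Measurable φ) (hk : Measurable k) :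
    ∫⁻ ω, φ (eulerPath b h x₀ (fun u => W u ω) i) *
        k (eulerPath b h x₀ (fun u => W u ω) (i + n)) ∂P ≤
      ((√(2 * Real.pi * (n * h : ℝ≥0)))⁻¹.toNNReal * (lowConst K (n * h))⁻¹ : ℝ≥0) * (∫⁻ y, k y) *
      ∫⁻ ω, φ (eulerPath b h x₀ (fun u => W u ω) i) ∂P := by
  have hv : (n * h : ℝ≥0) ≠ 0 := mul_ne_zero (by exact_mod_cast hn.ne') hh
  have mφ : Measurable fun ω => φ (eulerPath b h x₀ (fun u => W u ω) i) :=
    hφ.comp (measurable_eulerPath hb mW i)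
  rw [lintegral_eulerPath_eq hb hW mW hh i n hn hφ hk, ← lintegral_const_mul _ mφ]
  refine lintegral_mono fun ω => ?_
  rw [mul_comm]
  refine mul_le_mul_left ?_ _
  exact lintegral_gaussian_comp_le hv (lowConst_pos K _)
    (fun z z' hz => eulerPath_bilipschitz hb hKh hh _ i n hn hz) hk

/-- A lower bound for the density of the Euler scheme at `t` given its past at `s`, in terms of its
value `y` at `t` and the increment `z` of the Brownian motion over an interval of length `τ`. -/
noncomputable def lowDensity (K τ : ℝ≥0) (R y z : ℝ) : ENNReal :=
  gaussianPDF 0 τ ((lowConst K τ : ℝ)⁻¹ * (R + |y| + upConst K τ * |z|))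

/-- Given its past up to the index `i`, the Euler scheme at the index `i + n` has a density on
`[-R, R]` that is bounded below by `lowDensity`, up to a constant. -/
theorem le_lintegral_eulerPath (hb : LipschitzWith K b) (hW : IsPreBrownianReal W P)
    (mW : ∀ t, Measurable (W t)) (hh : h ≠ 0) (hKh : (K * h : ℝ) ≤ 1 / 2) (i n : ℕ) (hn : 0 < n)
    {φ k : ℝ → ENNReal} (hφ : Measurable φ) (hk : Measurable k) {R : ℝ} (hR0 : 0 ≤ R)
    (hR : ∀ x, R < |x| → k x = 0) :
    (∫⁻ ω, φ (eulerPath b h x₀ (fun u => W u ω) i) *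
        lowDensity K (n * h) R (eulerPath b h x₀ (fun u => W u ω) (i + n))
          (W ((i + n : ℕ) * h) ω - W (i * h) ω) ∂P) * (∫⁻ y, k y) ≤
      upConst K (n * h) * ∫⁻ ω, φ (eulerPath b h x₀ (fun u => W u ω) i) *
        k (eulerPath b h x₀ (fun u => W u ω) (i + n)) ∂P := by
  have hv : (n * h : ℝ≥0) ≠ 0 := mul_ne_zero (by exact_mod_cast hn.ne') hh
  have mφ : Measurable fun ω => φ (eulerPath b h x₀ (fun u => W u ω) i) :=
    hφ.comp (measurable_eulerPath hb mW i)
  have mY := measurable_eulerPath (h := h) (x₀ := x₀) hb mW (i + n)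
  have mD : Measurable fun ω => lowDensity K (n * h) R (eulerPath b h x₀ (fun u => W u ω) (i + n))
      (W ((i + n : ℕ) * h) ω - W (i * h) ω) := by
    refine (measurable_gaussianPDF _ _).comp (Measurable.const_mul ?_ _)
    exact ((mY.abs).const_add _).add (((mW _).sub (mW _)).abs.const_mul _)
  have mφD := mφ.mul mD
  simp only [Pi.mul_def] at mφD
  rw [lintegral_eulerPath_eq hb hW mW hh i n hn hφ hk,
    ← lintegral_mul_const _ mφD, ← lintegral_const_mul' _ _ ENNReal.coe_ne_top]
  refine lintegral_mono fun ω => ?_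
  set s : ℝ≥0 := i * h with hs
  set t : ℝ≥0 := (i + n : ℕ) * h with ht
  set ψ : ℝ → ℝ := fun z => eulerPath b h x₀ (fun u =>
    (W u ω - incrementCoeff s t u * (W t ω - W s ω)) + incrementCoeff s t u * z) (i + n) with hψdef
  have hψ : ∀ z z', z ≤ z' → lowConst K (n * h) * (z' - z) ≤ ψ z' - ψ z ∧
      ψ z' - ψ z ≤ upConst K (n * h) * (z' - z) :=
    fun z z' hz => eulerPath_bilipschitz hb hKh hh _ i n hn hz
  have hψZ : ψ (W t ω - W s ω) = eulerPath b h x₀ (fun u => W u ω) (i + n) := by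
    simp [hψdef]
  have h1 := le_lintegral_gaussian_comp hv (lowConst_pos K _) hψ hk hR
  -- The state for `z = 0` differs from the actual one by at most the Lipschitz constant times the
  -- actual increment, which makes the lower bound independent of the grid.
  have h2 : lowDensity K (n * h) R (eulerPath b h x₀ (fun u => W u ω) (i + n)) (W t ω - W s ω)
      ≤ gaussianPDF 0 (n * h) ((lowConst K (n * h) : ℝ)⁻¹ * (R + |ψ 0|)) := by
    refine ENNReal.ofReal_le_ofReal (gaussianPDFReal_le_of_abs_le _ ?_)
    have h3 := (abs_sub_le_of_bilipschitz hψ 0 (W t ω - W s ω)).2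
    rw [hψZ, sub_zero, abs_sub_comm] at h3
    have h4 := abs_sub_abs_le_abs_sub (ψ 0) (eulerPath b h x₀ (fun u => W u ω) (i + n))
    refine abs_le_abs_of_nonneg (by positivity) (mul_le_mul_of_nonneg_left ?_ (by positivity))
    linarith
  calc _ = φ (eulerPath b h x₀ (fun u => W u ω) i) *
        (lowDensity K (n * h) R (eulerPath b h x₀ (fun u => W u ω) (i + n)) (W t ω - W s ω)
          * ∫⁻ y, k y) := mul_assoc _ _ _
    _ ≤ φ (eulerPath b h x₀ (fun u => W u ω) i) *
        (upConst K (n * h) * ∫⁻ z, k (ψ z) ∂(gaussianReal 0 (n * h))) :=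
      mul_le_mul_right ((mul_le_mul_left h2 _).trans h1) _
    _ = _ := mul_left_comm _ _ _

end EulerEstimates

/-! ### Second moments -/

/-- A discrete Gronwall estimate for the square of the difference of the Euler scheme and its
driving path, which involves no increments of the driving path. -/
theorem sq_euler_sub_le {b : ℝ → ℝ} {K : ℝ≥0} (hb : LipschitzWith K b) {h : ℝ} (hh : 0 ≤ h)
    (hh1 : h ≤ 1) (x₀ : ℝ) {w : ℕ → ℝ} (hw : w 0 = 0) (k : ℕ) :
    (euler b h x₀ w k - w k) ^ 2 ≤ (1 + (1 + 6 * K ^ 2) * h) ^ k *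
      (x₀ ^ 2 + ∑ i ∈ Finset.range k, 6 * h * (b 0 ^ 2 + K ^ 2 * w i ^ 2)) := by
  induction k with
  | zero => simp [euler, hw]
  | succ k ih =>
    set v := euler b h x₀ w k - w k with hv
    set u := b (euler b h x₀ w k) with hu
    have hstep : euler b h x₀ w (k + 1) - w (k + 1) = v + h * u := by
      simp only [euler, hv, hu]; ring
    have hu1 : |u| ≤ |b 0| + K * |v| + K * |w k| := by
      have h1 := abs_sub_le_of_lipschitz hb (euler b h x₀ w k) 0
      have h2 := abs_sub_abs_le_abs_sub u (b 0)
      have h3 : |euler b h x₀ w k| ≤ |v| + |w k| := by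
        have := abs_add_le v (w k)
        rwa [hv, sub_add_cancel] at this
      rw [sub_zero] at h1
      have h4 := mul_le_mul_of_nonneg_left h3 K.2
      simp only [NNReal.val_eq_coe] at h4
      linarith
    have hu2 : u ^ 2 ≤ 3 * (b 0 ^ 2 + K ^ 2 * v ^ 2 + K ^ 2 * w k ^ 2) := by
      have h1 : u ^ 2 ≤ (|b 0| + K * |v| + K * |w k|) ^ 2 := by
        rw [← sq_abs u]; gcongr
      have e1 := sq_abs (b 0)
      have e2 := sq_abs v
      have e3 := sq_abs (w k)
      nlinarith [sq_nonneg (|b 0| - K * |v|), sq_nonneg (|b 0| - K * |w k|),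
        sq_nonneg (K * |v| - K * |w k|)]
    have hs : (v + h * u) ^ 2 ≤ (1 + (1 + 6 * K ^ 2) * h) * v ^ 2
        + 6 * h * (b 0 ^ 2 + K ^ 2 * w k ^ 2) := by
      have h1 : (v + h * u) ^ 2 ≤ v ^ 2 + h * v ^ 2 + 2 * h * u ^ 2 := by
        have : h * (h * u ^ 2) ≤ h * (1 * u ^ 2) := by gcongr
        nlinarith [mul_nonneg hh (sq_nonneg (v - u))]
      have h2 := mul_le_mul_of_nonneg_left hu2 hh
      nlinarith
    have hc : 1 ≤ (1 + (1 + 6 * (K : ℝ) ^ 2) * h) := by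
      have : 0 ≤ (1 + 6 * (K : ℝ) ^ 2) * h := by positivity
      linarith
    have hd : 0 ≤ 6 * h * (b 0 ^ 2 + K ^ 2 * w k ^ 2) := by positivity
    rw [hstep, Finset.sum_range_succ, pow_succ' (1 + (1 + 6 * (K : ℝ) ^ 2) * h) k]
    calc _ ≤ _ := hs
      _ ≤ (1 + (1 + 6 * K ^ 2) * h) * ((1 + (1 + 6 * K ^ 2) * h) ^ k *
            (x₀ ^ 2 + ∑ i ∈ Finset.range k, 6 * h * (b 0 ^ 2 + K ^ 2 * w i ^ 2)))
          + ((1 + (1 + 6 * K ^ 2) * h) * (1 + (1 + 6 * K ^ 2) * h) ^ k) *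
            (6 * h * (b 0 ^ 2 + K ^ 2 * w k ^ 2)) := by
          refine add_le_add (mul_le_mul_of_nonneg_left ih (by linarith)) ?_
          refine le_mul_of_one_le_left hd ?_
          rw [← pow_succ']
          exact one_le_pow₀ hc
      _ = _ := by ring

variable {X : ℝ≥0 → Ω → ℝ}

theorem integrable_sq_brownian (hW : IsPreBrownianReal W P) (t : ℝ≥0) :
    Integrable (fun ω => W t ω ^ 2) P :=
  (hW.isGaussianProcess.hasGaussianLaw_eval t).memLp_two.integrable_sq

theorem integral_sq_brownian (hW : IsPreBrownianReal W P) (t : ℝ≥0) :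
    ∫ ω, W t ω ^ 2 ∂P = t := by
  have h := hW.covariance_eval t t
  rw [covariance_self (hW.aemeasurable t),
    variance_of_integral_eq_zero (hW.aemeasurable t) (hW.integral_eval t), min_self] at h
  exact h

/-- The second moments of the Euler scheme are bounded uniformly in the step, on bounded time
intervals. -/
theorem lintegral_sq_eulerPath_le {b : ℝ → ℝ} {K : ℝ≥0} (hb : LipschitzWith K b)
    (hW : IsPreBrownianReal W P) {h : ℝ≥0} (hh : h ≤ 1) (x₀ : ℝ)
    {k : ℕ} {T : ℝ≥0} (hk : k * h = T) :
    ∫⁻ ω, ENNReal.ofReal (eulerPath b h x₀ (fun u => W u ω) k ^ 2) ∂P ≤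
      ENNReal.ofReal (2 * (Real.exp ((1 + 6 * K ^ 2) * T) *
        (x₀ ^ 2 + 6 * T * (b 0 ^ 2 + K ^ 2 * T))) + 2 * T) := by
  have hP := hW.isGaussianProcess.isProbabilityMeasure
  have hkT : (k : ℝ) * h = T := by exact_mod_cast congrArg NNReal.toReal hk
  set E := Real.exp ((1 + 6 * K ^ 2) * T) with hE
  set Y : Ω → ℝ := fun ω => 2 * (E * (x₀ ^ 2 + ∑ i ∈ Finset.range k,
    6 * h * (b 0 ^ 2 + K ^ 2 * W (i * h) ω ^ 2))) + 2 * W (k * h) ω ^ 2 with hY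
  have hi := integrable_sq_brownian hW
  have hterm : ∀ i : ℕ, Integrable (fun ω =>
      6 * (h : ℝ) * (b 0 ^ 2 + K ^ 2 * W (i * h) ω ^ 2)) P := fun i =>
    ((integrable_const _).add ((hi _).const_mul _)).const_mul _
  have hsum : Integrable (fun ω => ∑ i ∈ Finset.range k,
      6 * (h : ℝ) * (b 0 ^ 2 + K ^ 2 * W (i * h) ω ^ 2)) P :=
    integrable_finsetSum _ fun i _ => hterm i
  have hint1 : Integrable (fun ω => 2 * (E * (x₀ ^ 2 + ∑ i ∈ Finset.range k,
      6 * (h : ℝ) * (b 0 ^ 2 + K ^ 2 * W (i * h) ω ^ 2)))) P :=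
    (((integrable_const _).add hsum).const_mul _).const_mul _
  have hYint : Integrable Y P := hint1.add ((hi _).const_mul 2)
  have hY0 : ∀ ω, 0 ≤ Y ω := fun ω => by
    have : 0 ≤ ∑ i ∈ Finset.range k, 6 * (h : ℝ) * (b 0 ^ 2 + K ^ 2 * W (i * h) ω ^ 2) :=
      Finset.sum_nonneg fun i _ => by positivity
    positivity
  have hle : ∀ᵐ ω ∂P, eulerPath b h x₀ (fun u => W u ω) k ^ 2 ≤ Y ω := by
    filter_upwards [hW.eval_zero_ae_eq_zero] with ω h0
    have h1 := sq_euler_sub_le hb h.2 (by exact_mod_cast hh) x₀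
      (w := fun i => W (i * h) ω) (by simpa using h0) k
    have h2 : (1 + (1 + 6 * (K : ℝ) ^ 2) * h) ^ k ≤ E := by
      refine (one_add_pow_le_exp (by positivity) k).trans (le_of_eq ?_)
      rw [hE, ← hkT]; ring_nf
    have h3 : 0 ≤ x₀ ^ 2 + ∑ i ∈ Finset.range k,
        6 * (h : ℝ) * (b 0 ^ 2 + K ^ 2 * W (i * h) ω ^ 2) :=
      add_nonneg (sq_nonneg _) (Finset.sum_nonneg fun i _ => by positivity)
    have h4 := h1.trans (mul_le_mul_of_nonneg_right h2 h3)
    have h5 : ∀ y w S : ℝ, (y - w) ^ 2 ≤ S → y ^ 2 ≤ 2 * S + 2 * w ^ 2 := fun y w S h => by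
      nlinarith [sq_nonneg (y - 2 * w)]
    exact h5 _ _ _ h4
  refine (lintegral_mono_ae (hle.mono fun ω hω => ENNReal.ofReal_le_ofReal hω)).trans ?_
  rw [← ofReal_integral_eq_lintegral_ofReal hYint (ae_of_all _ hY0)]
  refine ENNReal.ofReal_le_ofReal ?_
  have hval : ∫ ω, Y ω ∂P = 2 * (E * (x₀ ^ 2 + ∑ i ∈ Finset.range k,
      6 * h * (b 0 ^ 2 + K ^ 2 * (i * h)))) + 2 * (k * h) := by
    simp only [hY]
    rw [integral_add hint1 ((hi _).const_mul 2), integral_const_mul, integral_const_mul,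
      integral_add (integrable_const _) hsum, integral_finsetSum _ fun i _ => hterm i,
      integral_const_mul, integral_sq_brownian hW]
    simp only [integral_const, probReal_univ, one_smul]
    have hsq : ∀ i : ℕ, ∫ ω, 6 * (h : ℝ) * (b 0 ^ 2 + K ^ 2 * W (i * h) ω ^ 2) ∂P
        = 6 * h * (b 0 ^ 2 + K ^ 2 * (i * h)) := fun i => by
      rw [integral_const_mul, integral_add (integrable_const _) ((hi _).const_mul _),
        integral_const_mul, integral_sq_brownian hW]
      simp
    simp only [hsq, NNReal.coe_mul, NNReal.coe_natCast]
  rw [hval, hkT]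
  have hsum_le : ∑ i ∈ Finset.range k, 6 * (h : ℝ) * (b 0 ^ 2 + K ^ 2 * (i * h))
      ≤ 6 * T * (b 0 ^ 2 + K ^ 2 * T) := by
    calc _ ≤ ∑ i ∈ Finset.range k, 6 * (h : ℝ) * (b 0 ^ 2 + K ^ 2 * T) := by
          refine Finset.sum_le_sum fun i hi => ?_
          have : (i : ℝ) * h ≤ T := by
            rw [← hkT]
            have : (i : ℝ) ≤ k := by exact_mod_cast (Finset.mem_range.1 hi).le
            gcongr
          gcongr
      _ = _ := by rw [Finset.sum_const, Finset.card_range, nsmul_eq_mul, ← hkT]; ring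
  gcongr

/-! ### The diffusion as a limit of Euler schemes -/

/-- `X` is, at all multiples of any `δ`, the almost sure limit of the Euler schemes of steps
`δ / (n + 1)` that are driven by the Brownian motion `W`. -/
structure IsEulerLimit (P : Measure Ω) (b : ℝ → ℝ) (x₀ : ℝ) (W X : ℝ≥0 → Ω → ℝ) : Prop where
  brownian : IsPreBrownianReal W P
  measurable_driver : ∀ t, Measurable (W t)
  measurable_process : ∀ t, Measurable (X t)
  tendsto : ∀ (δ : ℝ≥0) (j : ℕ), ∀ᵐ ω ∂P, Filter.Tendsto (fun n : ℕ =>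
    eulerPath b (δ / (n + 1 : ℝ≥0)) x₀ (fun u => W u ω) (j * (n + 1)))
    Filter.atTop (nhds (X (j * δ) ω))

/-- As the noise is additive, the Euler schemes converge along every path. -/
theorem IsDiffusion.exists_isEulerLimit {b : ℝ → ℝ} {K : ℝ≥0} (hb : LipschitzWith K b) {x₀ : ℝ}
    (hX : IsDiffusion P b x₀ X) : ∃ W, IsEulerLimit P b x₀ W X := by
  obtain ⟨𝓕, W, hW, aW, -, aX, hc, heq⟩ := hX
  refine ⟨W, hW.toIsPreBrownianReal, fun t => (aW t).mono (𝓕.le t) le_rfl,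
    fun t => (aX t).mono (𝓕.le t) le_rfl, fun δ j => ?_⟩
  filter_upwards [hc, heq, hW.eval_zero_ae_eq_zero] with ω h1 h2 h3
  exact tendsto_euler hb h1 h3 h2 δ j

theorem eventually_step_le (K δ : ℝ≥0) :
    ∀ᶠ n : ℕ in Filter.atTop, (K * (δ / (n + 1 : ℝ≥0) : ℝ≥0) : ℝ) ≤ 1 / 2 := by
  obtain ⟨n₀, hn₀⟩ := exists_nat_ge (2 * (K * δ : ℝ))
  filter_upwards [Filter.eventually_ge_atTop n₀] with n hn
  have : (n₀ : ℝ) ≤ n := by exact_mod_cast hn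
  push_cast
  rw [← mul_div_assoc, div_le_iff₀ (by positivity)]
  linarith

namespace IsEulerLimit

variable {b : ℝ → ℝ} {K : ℝ≥0} {x₀ : ℝ}

/-- By Fatou's lemma, the uniform bound on the second moments of the Euler schemes is inherited by
the diffusion. -/
theorem lintegral_sq_lt_top (hb : LipschitzWith K b) (hX : IsEulerLimit P b x₀ W X) (δ : ℝ≥0)
    (j : ℕ) : ∫⁻ ω, ENNReal.ofReal (X (j * δ) ω ^ 2) ∂P < ⊤ := by
  obtain ⟨n₀, hn₀⟩ := exists_nat_ge δ
  have hmeas : ∀ n : ℕ, Measurable fun ω => ENNReal.ofReal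
      (eulerPath b (δ / (n + 1 : ℝ≥0)) x₀ (fun u => W u ω) (j * (n + 1)) ^ 2) := fun n =>
    ((measurable_eulerPath hb hX.measurable_driver _).pow_const 2).ennreal_ofReal
  have hlim : ∫⁻ ω, ENNReal.ofReal (X (j * δ) ω ^ 2) ∂P = ∫⁻ ω, Filter.liminf (fun n : ℕ =>
      ENNReal.ofReal (eulerPath b (δ / (n + 1 : ℝ≥0)) x₀ (fun u => W u ω) (j * (n + 1)) ^ 2))
      Filter.atTop ∂P := by
    refine lintegral_congr_ae ?_
    filter_upwards [hX.tendsto δ j] with ω hω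
    exact (((ENNReal.continuous_ofReal.comp (continuous_pow 2)).tendsto _).comp hω).liminf_eq.symm
  rw [hlim]
  refine (lintegral_liminf_le hmeas).trans_lt (lt_of_le_of_lt
    (Filter.liminf_le_of_frequently_le' (Filter.Eventually.frequently ?_)) (ENNReal.ofReal_lt_top
      (r := 2 * (Real.exp ((1 + 6 * K ^ 2) * (j * δ : ℝ≥0)) *
        (x₀ ^ 2 + 6 * (j * δ : ℝ≥0) * (b 0 ^ 2 + K ^ 2 * (j * δ : ℝ≥0)))) + 2 * (j * δ : ℝ≥0))))
  filter_upwards [Filter.eventually_ge_atTop n₀] with n hn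
  refine lintegral_sq_eulerPath_le hb hX.brownian ?_ x₀ ?_
  · rw [div_le_one (by positivity)]
    refine hn₀.trans ?_
    have : (n₀ : ℝ≥0) ≤ n := by exact_mod_cast hn
    exact this.trans (by simp)
  · push_cast
    rw [mul_assoc, mul_div_cancel₀ _ (by positivity)]

/-- Convergence of the joint law of the Euler scheme at two times and a further random variable. -/
theorem tendsto_lintegral (hb : LipschitzWith K b) (hX : IsEulerLimit P b x₀ W X) (δ : ℝ≥0)
    (i j : ℕ) {F : ℝ → ℝ → ℝ → ENNReal} (hF : Continuous fun p : ℝ × ℝ × ℝ => F p.1 p.2.1 p.2.2)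
    {B : ℝ≥0} (hB : ∀ x y z, F x y z ≤ B) {Z : Ω → ℝ} (hZ : Measurable Z) :
    Filter.Tendsto (fun n : ℕ => ∫⁻ ω,
      F (eulerPath b (δ / (n + 1 : ℝ≥0)) x₀ (fun u => W u ω) (i * (n + 1)))
        (eulerPath b (δ / (n + 1 : ℝ≥0)) x₀ (fun u => W u ω) (j * (n + 1))) (Z ω) ∂P)
      Filter.atTop (nhds (∫⁻ ω, F (X (i * δ) ω) (X (j * δ) ω) (Z ω) ∂P)) := by
  have hP := hX.brownian.isGaussianProcess.isProbabilityMeasure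
  refine tendsto_lintegral_of_dominated_convergence (fun _ => (B : ENNReal)) (fun n => ?_)
    (fun n => ae_of_all _ fun ω => hB _ _ _) (by simp) ?_
  · exact hF.measurable.comp ((measurable_eulerPath hb hX.measurable_driver _).prodMk
      ((measurable_eulerPath hb hX.measurable_driver _).prodMk hZ))
  · filter_upwards [hX.tendsto δ i, hX.tendsto δ j] with ω h1 h2
    exact (hF.tendsto (X (i * δ) ω, X (j * δ) ω, Z ω)).comp
      (h1.prodMk_nhds (h2.prodMk_nhds tendsto_const_nhds))

/-- The conditional law of `X_t` given the past up to `s < t` has a bounded density. -/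
theorem lintegral_mul_le (hb : LipschitzWith K b) (hX : IsEulerLimit P b x₀ W X) {δ : ℝ≥0}
    (hδ : δ ≠ 0) {i j : ℕ} (hij : i < j) :
    ∃ C : ℝ≥0, ∀ φ k : ℝ → ℝ≥0, Continuous φ → Continuous k → ∀ B : ℝ≥0,
      (∀ x, φ x ≤ B) → (∀ x, k x ≤ B) →
      ∫⁻ ω, φ (X (i * δ) ω) * k (X (j * δ) ω) ∂P ≤
        C * (∫⁻ y, k y) * ∫⁻ ω, φ (X (i * δ) ω) ∂P := by
  obtain ⟨m, hm, rfl⟩ : ∃ m, 0 < m ∧ i + m = j := ⟨j - i, by omega, by omega⟩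
  set τ : ℝ≥0 := m * δ with hτ
  refine ⟨(√(2 * Real.pi * τ))⁻¹.toNNReal * (lowConst K τ)⁻¹, fun φ k hφ hk B hφB hkB => ?_⟩
  -- If `∫ k = ⊤`, the right-hand side is `⊤` or, when `φ (X_s)` vanishes almost surely, `0`.
  by_cases hk0 : ∫⁻ y, (k y : ENNReal) = ⊤
  · by_cases hφ0 : ∫⁻ ω, (φ (X (i * δ) ω) : ENNReal) ∂P = 0
    · refine le_trans (le_of_eq ?_) zero_le
      rw [lintegral_eq_zero_iff (by
        exact (hφ.measurable.comp (hX.measurable_process _)).coe_nnreal_ennreal)] at hφ0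
      rw [lintegral_eq_zero_iff' (by
        exact ((hφ.measurable.comp (hX.measurable_process _)).coe_nnreal_ennreal.mul
          (hk.measurable.comp (hX.measurable_process _)).coe_nnreal_ennreal).aemeasurable)]
      filter_upwards [hφ0] with ω hω
      simp only [Pi.zero_apply] at hω ⊢
      rw [hω, zero_mul]
    · rw [hk0, ENNReal.mul_top, ENNReal.top_mul hφ0]
      · exact le_top
      · have h1 := lowConst_pos K τ
        have h2 : (0 : ℝ) < 2 * Real.pi * τ := by positivity
        positivity
  have h1 := hX.tendsto_lintegral hb δ i (i + m) (F := fun x y _ => φ x * k y) (B := B * B)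
    (by
      have e1 : Continuous fun p : ℝ × ℝ × ℝ => ((φ p.1 * k p.2.1 : ℝ≥0) : ENNReal) := by fun_prop
      simpa using e1)
    (fun x y _ => by exact_mod_cast mul_le_mul' (hφB x) (hkB y)) (measurable_const (a := (0 : ℝ)))
  have h2 := hX.tendsto_lintegral hb δ i (i + m) (F := fun x _ _ => φ x) (B := B)
    (by fun_prop) (fun x y _ => by exact_mod_cast hφB x) (measurable_const (a := (0 : ℝ)))
  refine le_of_tendsto_of_tendsto h1
    (ENNReal.Tendsto.const_mul h2 (Or.inr (ENNReal.mul_ne_top ENNReal.coe_ne_top hk0))) ?_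
  filter_upwards [eventually_step_le K δ] with n hn
  have h3 := lintegral_eulerPath_le (x₀ := x₀) hb hX.brownian hX.measurable_driver
    (h := δ / (n + 1 : ℝ≥0)) (by positivity) hn (i * (n + 1)) (m * (n + 1)) (by positivity)
    hφ.measurable.coe_nnreal_ennreal hk.measurable.coe_nnreal_ennreal
  have h4 : ((m * (n + 1) : ℕ) : ℝ≥0) * (δ / (n + 1 : ℝ≥0)) = τ := by
    push_cast
    rw [mul_assoc, mul_div_cancel₀ _ (by positivity)]
  rw [h4, ← add_mul] at h3
  exact h3

/-- The conditional law of `X_t` given the past up to `s < t` has, on any bounded interval, a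
density that is bounded below by a positive random variable. -/
theorem le_lintegral_mul (hb : LipschitzWith K b) (hX : IsEulerLimit P b x₀ W X) {δ : ℝ≥0}
    (hδ : δ ≠ 0) {i j : ℕ} (hij : i < j) {R : ℝ} (hR0 : 0 ≤ R) :
    ∃ (ρ : Ω → ENNReal) (C : ℝ≥0), Measurable ρ ∧ (∀ ω, ρ ω ≠ 0) ∧ (∀ ω, ρ ω ≤ C) ∧
      ∀ φ k : ℝ → ℝ≥0, Continuous φ → Continuous k → ∀ B : ℝ≥0,
      (∀ x, φ x ≤ B) → (∀ x, k x ≤ B) → (∀ x, R < |x| → k x = 0) →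
      (∫⁻ ω, φ (X (i * δ) ω) * ρ ω ∂P) * (∫⁻ y, k y) ≤
        ∫⁻ ω, φ (X (i * δ) ω) * k (X (j * δ) ω) ∂P := by
  obtain ⟨m, hm, rfl⟩ : ∃ m, 0 < m ∧ i + m = j := ⟨j - i, by omega, by omega⟩
  set τ : ℝ≥0 := m * δ with hτ
  have hτ0 : τ ≠ 0 := by positivity
  set Z : Ω → ℝ := fun ω => W ((i + m : ℕ) * δ) ω - W (i * δ) ω with hZ
  have mZ : Measurable Z := (hX.measurable_driver _).sub (hX.measurable_driver _)
  set D : ℝ≥0 := (√(2 * Real.pi * τ))⁻¹.toNNReal with hD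
  have hcont : Continuous fun p : ℝ × ℝ => lowDensity K τ R p.1 p.2 := by
    refine (continuous_gaussianPDF τ).comp ?_
    fun_prop
  have hup0 := upConst_pos K τ
  refine ⟨fun ω => ((upConst K τ)⁻¹ : ℝ≥0) * lowDensity K τ R (X ((i + m : ℕ) * δ) ω) (Z ω),
    (upConst K τ)⁻¹ * D, ?_, ?_, ?_, ?_⟩
  · exact (hcont.measurable.comp ((hX.measurable_process _).prodMk mZ)).const_mul _
  · intro ω
    refine mul_ne_zero (by positivity) ?_
    exact (ENNReal.ofReal_pos.2 (gaussianPDFReal_pos _ _ _ hτ0)).ne'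
  · intro ω
    rw [ENNReal.coe_mul]
    exact mul_le_mul_right (gaussianPDF_le_coe _ _) _
  intro φ k hφ hk B hφB hkB hkR
  have hk0 : ∫⁻ y, (k y : ENNReal) ≠ ⊤ := by
    have : ∀ y, (k y : ENNReal) ≤ (Set.Icc (-R) R).indicator (fun _ => (B : ENNReal)) y := by
      intro y
      by_cases hy : y ∈ Set.Icc (-R) R
      · rw [Set.indicator_of_mem hy]
        exact_mod_cast hkB y
      · rw [hkR y (by rw [Set.mem_Icc, ← abs_le] at hy; exact not_le.1 hy)]
        simp
    refine ((lintegral_mono this).trans_lt ?_).ne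
    rw [lintegral_indicator measurableSet_Icc, setLIntegral_const, Real.volume_Icc]
    exact ENNReal.mul_lt_top ENNReal.coe_lt_top ENNReal.ofReal_lt_top
  have h1 := hX.tendsto_lintegral hb δ i (i + m) (F := fun x y _ => φ x * k y) (B := B * B)
    (by
      have e1 : Continuous fun p : ℝ × ℝ × ℝ => ((φ p.1 * k p.2.1 : ℝ≥0) : ENNReal) := by fun_prop
      simpa using e1)
    (fun x y _ => by exact_mod_cast mul_le_mul' (hφB x) (hkB y)) (measurable_const (a := (0 : ℝ)))
  have h2 := hX.tendsto_lintegral hb δ i (i + m)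
    (F := fun x y z => φ x * lowDensity K τ R y z) (B := B * D)
    (by
      have e1 : Continuous fun p : ℝ × ℝ × ℝ => lowDensity K τ R p.2.1 p.2.2 :=
        hcont.comp continuous_snd
      have e2 : Continuous fun p : ℝ × ℝ × ℝ => (φ p.1 : ENNReal) := by fun_prop
      refine continuous_iff_continuousAt.2 fun p => ENNReal.Tendsto.mul e2.continuousAt
        (Or.inr ?_) e1.continuousAt (Or.inr ENNReal.coe_ne_top)
      exact ENNReal.ofReal_ne_top)
    (fun x y z => by
      rw [ENNReal.coe_mul]
      exact mul_le_mul' (by exact_mod_cast hφB x) (gaussianPDF_le_coe _ _)) mZ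
  have hlim : (∫⁻ ω, φ (X (i * δ) ω) * lowDensity K τ R (X ((i + m : ℕ) * δ) ω) (Z ω) ∂P)
      * (∫⁻ y, k y) ≤ upConst K τ * ∫⁻ ω, φ (X (i * δ) ω) * k (X ((i + m : ℕ) * δ) ω) ∂P := by
    refine le_of_tendsto_of_tendsto (ENNReal.Tendsto.mul_const h2 (Or.inr hk0))
      (ENNReal.Tendsto.const_mul h1 (Or.inr ENNReal.coe_ne_top)) ?_
    filter_upwards [eventually_step_le K δ] with n hn
    have h3 := le_lintegral_eulerPath (x₀ := x₀) hb hX.brownian hX.measurable_driver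
      (h := δ / (n + 1 : ℝ≥0)) (by positivity) hn (i * (n + 1)) (m * (n + 1)) (by positivity)
      hφ.measurable.coe_nnreal_ennreal hk.measurable.coe_nnreal_ennreal hR0
      (fun x hx => by simp [hkR x hx])
    have h4 : ∀ l : ℕ, ((l * (n + 1) : ℕ) : ℝ≥0) * (δ / (n + 1 : ℝ≥0)) = l * δ := by
      intro l
      push_cast
      rw [mul_assoc, mul_div_cancel₀ _ (by positivity)]
    rw [← add_mul, h4, h4, h4] at h3
    exact h3
  have hcancel : (((upConst K τ)⁻¹ : ℝ≥0) : ENNReal) * upConst K τ = 1 := by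
    rw [← ENNReal.coe_mul, inv_mul_cancel₀ hup0.ne', ENNReal.coe_one]
  calc _ = ((upConst K τ)⁻¹ : ℝ≥0) * ((∫⁻ ω, φ (X (i * δ) ω) *
        lowDensity K τ R (X ((i + m : ℕ) * δ) ω) (Z ω) ∂P) * (∫⁻ y, k y)) := by
        rw [← mul_assoc, ← lintegral_const_mul' _ _ ENNReal.coe_ne_top]
        congr 1
        exact lintegral_congr fun ω => mul_left_comm _ _ _
    _ ≤ ((upConst K τ)⁻¹ : ℝ≥0) * (upConst K τ *
        ∫⁻ ω, φ (X (i * δ) ω) * k (X ((i + m : ℕ) * δ) ω) ∂P) := mul_le_mul_right hlim _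
    _ = _ := by rw [← mul_assoc, hcancel, one_mul]

end IsEulerLimit

/-! ### Comparison of a continuous function with constants by tent functions -/

/-- The tent function of height `1` around `y`, supported in the interval of radius `r`. -/
noncomputable def tent (y r x : ℝ) : ℝ≥0 := (1 - |x - y| / r).toNNReal

theorem continuous_tent (y r : ℝ) : Continuous (tent y r) := by
  unfold tent
  fun_prop

theorem tent_le_one {r : ℝ} (hr : 0 < r) (y x : ℝ) : tent y r x ≤ 1 := by
  rw [tent, Real.toNNReal_le_one]
  have : 0 ≤ |x - y| / r := by positivity
  linarith

theorem tent_self (y r : ℝ) : tent y r y = 1 := by simp [tent]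

theorem tent_eq_zero {y r x : ℝ} (hr : 0 < r) (h : r ≤ |x - y|) : tent y r x = 0 := by
  rw [tent, Real.toNNReal_eq_zero, sub_nonpos, le_div_iff₀ hr]
  linarith

theorem tent_eq_zero_of_abs {y r x : ℝ} (hr : 0 < r) (hr1 : r ≤ 1) (h : |y| + 1 < |x|) :
    tent y r x = 0 := by
  refine tent_eq_zero hr ?_
  have := abs_sub_abs_le_abs_sub x y
  linarith

theorem lintegral_tent_ne_top (μ : Measure ℝ) [IsFiniteMeasure μ] {r : ℝ} (hr : 0 < r) (y : ℝ) :
    ∫⁻ x, tent y r x ∂μ ≠ ⊤ := by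
  refine ((lintegral_mono (g := fun _ => (1 : ENNReal)) fun x => ?_).trans_lt ?_).ne
  · exact ENNReal.coe_le_one_iff.2 (tent_le_one hr y x)
  · simp

/-- A continuous function is at most `C` at `y` if its means with respect to all tent functions
around `y` are. -/
theorem le_of_lintegral_tent_le {μ : Measure ℝ} [IsFiniteMeasure μ] {F : ℝ → ENNReal}
    (hF : Continuous F) {y : ℝ} {C : ENNReal}
    (hpos : ∀ r, 0 < r → r ≤ 1 → ∫⁻ x, tent y r x ∂μ ≠ 0)
    (h : ∀ r, 0 < r → r ≤ 1 → ∫⁻ x, tent y r x * F x ∂μ ≤ C * ∫⁻ x, tent y r x ∂μ) :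
    F y ≤ C := by
  by_contra! hlt
  obtain ⟨c, hc1, hc2⟩ := exists_between hlt
  obtain ⟨r, hr, hball⟩ := Metric.isOpen_iff.1 (isOpen_lt continuous_const hF) y hc2
  have hr' : 0 < min r 1 := lt_min hr one_pos
  have h1 := h _ hr' (min_le_right _ _)
  have h2 : c * ∫⁻ x, tent y (min r 1) x ∂μ ≤ ∫⁻ x, tent y (min r 1) x * F x ∂μ := by
    rw [← lintegral_const_mul' _ _ hc2.ne_top]
    refine lintegral_mono fun x => ?_
    by_cases hx : dist x y < min r 1
    · rw [mul_comm]
      exact mul_le_mul_right (hball (hx.trans_le (min_le_left _ _)) : c < F x).le _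
    · rw [tent_eq_zero hr' (by rwa [Real.dist_eq, not_lt] at hx)]
      simp
  exact absurd ((ENNReal.mul_le_mul_iff_left (hpos _ hr' (min_le_right _ _))
    (lintegral_tent_ne_top μ hr' y)).1 (h2.trans h1)) (not_le.2 hc1)

/-- A continuous function is at least `C` at `y` if its means with respect to all tent functions
around `y` are. -/
theorem le_of_le_lintegral_tent {μ : Measure ℝ} [IsFiniteMeasure μ] {F : ℝ → ENNReal}
    (hF : Continuous F) {y : ℝ} {C : ENNReal}
    (hpos : ∀ r, 0 < r → r ≤ 1 → ∫⁻ x, tent y r x ∂μ ≠ 0)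
    (h : ∀ r, 0 < r → r ≤ 1 → C * ∫⁻ x, tent y r x ∂μ ≤ ∫⁻ x, tent y r x * F x ∂μ) :
    C ≤ F y := by
  by_contra! hlt
  obtain ⟨c, hc1, hc2⟩ := exists_between hlt
  obtain ⟨r, hr, hball⟩ := Metric.isOpen_iff.1 (isOpen_lt hF continuous_const) y hc1
  have hr' : 0 < min r 1 := lt_min hr one_pos
  have h1 := h _ hr' (min_le_right _ _)
  have h2 : ∫⁻ x, tent y (min r 1) x * F x ∂μ ≤ c * ∫⁻ x, tent y (min r 1) x ∂μ := by
    rw [← lintegral_const_mul' _ _ hc2.ne_top]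
    refine lintegral_mono fun x => ?_
    by_cases hx : dist x y < min r 1
    · rw [mul_comm]
      exact mul_le_mul_left (hball (hx.trans_le (min_le_left _ _)) : F x < c).le _
    · rw [tent_eq_zero hr' (by rwa [Real.dist_eq, not_lt] at hx)]
      simp
  exact absurd ((ENNReal.mul_le_mul_iff_left (hpos _ hr' (min_le_right _ _))
    (lintegral_tent_ne_top μ hr' y)).1 (h1.trans h2)) (not_le.2 hc2)

theorem lintegral_ne_zero_of_continuous {k : ℝ → ℝ≥0} (hk : Continuous k) {y : ℝ} (hy : k y ≠ 0) :
    ∫⁻ x, (k x : ENNReal) ≠ 0 := by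
  intro h
  rw [lintegral_eq_zero_iff hk.measurable.coe_nnreal_ennreal] at h
  have h' : k =ᵐ[volume] fun _ => 0 := by
    filter_upwards [h] with x hx
    simpa using hx
  exact hy (congrFun ((Continuous.ae_eq_iff_eq volume hk continuous_const).1 h') y)

/-! ### Estimates for the bridge -/

namespace IsEulerLimit

variable {b : ℝ → ℝ} {K : ℝ≥0} {x₀ : ℝ}

/-- The law of the diffusion at a positive time charges all nonempty open sets. -/
theorem lintegral_ne_zero (hb : LipschitzWith K b) (hX : IsEulerLimit P b x₀ W X) {δ : ℝ≥0}
    (hδ : δ ≠ 0) {j : ℕ} (hj : 0 < j) {k : ℝ → ℝ≥0} (hk : Continuous k) (hk1 : ∀ x, k x ≤ 1)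
    {R : ℝ} (hR0 : 0 ≤ R) (hR : ∀ x, R < |x| → k x = 0) {y : ℝ} (hy : k y ≠ 0) :
    ∫⁻ ω, k (X (j * δ) ω) ∂P ≠ 0 := by
  have hP := hX.brownian.isGaussianProcess.isProbabilityMeasure
  obtain ⟨ρ, -, mρ, hρ0, -, hρ⟩ := hX.le_lintegral_mul hb hδ hj hR0
  have h1 := hρ (fun _ => 1) k continuous_const hk 1 (fun _ => le_rfl) hk1 hR
  simp only [ENNReal.coe_one, one_mul] at h1
  have h2 : ∫⁻ ω, ρ ω ∂P ≠ 0 := by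
    intro h
    rw [lintegral_eq_zero_iff mρ] at h
    obtain ⟨ω, hω⟩ := h.exists
    exact hρ0 ω hω
  intro h
  rw [h, nonpos_iff_eq_zero, mul_eq_zero] at h1
  exact h1.elim h2 (lintegral_ne_zero_of_continuous hk hy)

end IsEulerLimit

section Bridge

variable {T : ℝ≥0} {Q : Kernel ℝ (Set.Iic T → ℝ)}

theorem measurable_U (M : ℕ) (m : Fin (M + 1)) : Measurable (U (T := T) M m) :=
  measurable_pi_apply _

/-- The disintegration of the law of the path with respect to its endpoint. -/
theorem IsBridgeKernel.lintegral_eq [IsProbabilityMeasure P] (hQ : IsBridgeKernel P X T Q)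
    {G : (Set.Iic T → ℝ) → ENNReal} (hG : Measurable G) {k : ℝ → ENNReal} (hk : Measurable k) :
    ∫⁻ ω, G (fun t => X t ω) * k (X T ω) ∂P = ∫⁻ y, k y * ∫⁻ w, G w ∂(Q y) ∂(P.map (X T)) := by
  have hM := hQ.isMarkov
  have hlaw : HasLaw _ _ _ := hQ.condDistrib
  have := Measure.isProbabilityMeasure_map (μ := P) hQ.condDistrib.aemeasurable_fst
  have hF : Measurable fun p : ℝ × (Set.Iic T → ℝ) => G p.2 * k p.1 :=
    (hG.comp measurable_snd).mul (hk.comp measurable_fst)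
  calc _ = ∫⁻ p, G p.2 * k p.1 ∂(P.map fun ω => (X T ω, fun t : Set.Iic T => X t ω)) := by
        rw [lintegral_map' hF.aemeasurable hlaw.aemeasurable]
    _ = _ := by
        rw [hlaw.map_eq, Measure.lintegral_compProd hF]
        refine lintegral_congr fun y => ?_
        rw [← lintegral_const_mul _ hG]
        exact lintegral_congr fun w => mul_comm _ _

theorem IsBridgeKernel.continuous_lintegral (hQ : IsBridgeKernel P X T Q) (M : ℕ)
    (m : Fin (M + 1)) {φ : ℝ → ℝ≥0} (hφ : Continuous φ) {B : ℝ≥0} (hB : ∀ x, φ x ≤ B) :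
    Continuous fun y => ∫⁻ w, φ (U M m w) ∂(Q y) := by
  have hM := hQ.isMarkov
  set t : Set.Iic T := ⟨m * step T M, mul_step_le T M m⟩ with ht
  let F : (({t} : Finset (Set.Iic T)) → ℝ) →ᵇ ℝ :=
    BoundedContinuousFunction.ofNormedAddCommGroup
      (fun v => (φ (v ⟨t, Finset.mem_singleton_self t⟩) : ℝ)) (by fun_prop) B
      (fun v => by simpa using hB _)
  have h := ENNReal.continuous_ofReal.comp (hQ.continuous_fdd {t} F)
  convert h using 2 with y
  have hint : Integrable (fun w => (φ (U M m w) : ℝ)) (Q y) := by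
    refine Integrable.of_bound (C := B) ?_ (ae_of_all _ fun w => by simpa using hB _)
    exact (hφ.measurable.comp (measurable_U M m)).coe_nnreal_real.aestronglyMeasurable
  have := ofReal_integral_eq_lintegral_ofReal hint (ae_of_all _ fun w => NNReal.coe_nonneg _)
  simp only [ENNReal.ofReal_coe_nnreal] at this
  exact this.symm

theorem mul_step_self (T : ℝ≥0) {M : ℕ} (hM : M ≠ 0) : (M : ℝ≥0) * step T M = T :=
  mul_div_cancel₀ T (by exact_mod_cast hM)

theorem step_ne_zero (hT : 0 < T) {M : ℕ} (hM : M ≠ 0) : step T M ≠ 0 := by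
  rw [step]
  have : (M : ℝ≥0) ≠ 0 := by exact_mod_cast hM
  positivity

variable {b : ℝ → ℝ} {K : ℝ≥0} {x₀ : ℝ}

theorem lintegral_tent_map_ne_zero (hb : LipschitzWith K b) (hX : IsEulerLimit P b x₀ W X)
    (hT : 0 < T) (y : ℝ) {r : ℝ} (hr : 0 < r) (hr1 : r ≤ 1) :
    ∫⁻ x, tent y r x ∂(P.map (X T)) ≠ 0 := by
  rw [lintegral_map (continuous_tent y r).measurable.coe_nnreal_ennreal (hX.measurable_process T)]
  have := hX.lintegral_ne_zero hb hT.ne' one_pos (continuous_tent y r) (tent_le_one hr y)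
    (R := |y| + 1) (by positivity) (fun x hx => tent_eq_zero_of_abs hr hr1 hx) (y := y)
    (by simp [tent_self])
  simpa using this

/-- Second moments of the bridge, for bounded truncations: the joint density of `(X_s, X_T)` is
compared with the density of `X_T` near the endpoint. -/
theorem IsBridgeKernel.exists_lintegral_le (hQ : IsBridgeKernel P X T Q) (hb : LipschitzWith K b)
    (hX : IsEulerLimit P b x₀ W X) (hT : 0 < T) {M : ℕ} (hM : M ≠ 0) (m : Fin (M + 1)) (y : ℝ) :
    ∃ C : ENNReal, C ≠ ⊤ ∧ ∀ φ : ℝ → ℝ≥0, Continuous φ → ∀ B : ℝ≥0, (∀ x, φ x ≤ B) →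
      (∀ x, (φ x : ENNReal) ≤ ENNReal.ofReal (x ^ 2)) → ∫⁻ w, φ (U M m w) ∂(Q y) ≤ C := by
  have hP := hX.brownian.isGaussianProcess.isProbabilityMeasure
  have := Measure.isProbabilityMeasure_map (μ := P) hQ.condDistrib.aemeasurable_fst
  have hδ := step_ne_zero hT hM
  have hMT := mul_step_self T hM
  -- It suffices to compare the means over tent functions of the endpoint.
  suffices H : ∃ C : ENNReal, C ≠ ⊤ ∧ ∀ φ : ℝ → ℝ≥0, Continuous φ → ∀ B : ℝ≥0, (∀ x, φ x ≤ B) →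
      (∀ x, (φ x : ENNReal) ≤ ENNReal.ofReal (x ^ 2)) → ∀ r, 0 < r → r ≤ 1 →
      ∫⁻ ω, φ (X (m * step T M) ω) * tent y r (X T ω) ∂P ≤ C * ∫⁻ ω, tent y r (X T ω) ∂P by
    obtain ⟨C, hC, H⟩ := H
    refine ⟨C, hC, fun φ hφ B hB hφ2 => ?_⟩
    refine le_of_lintegral_tent_le (μ := P.map (X T)) (hQ.continuous_lintegral M m hφ hB)
      (fun r hr hr1 => lintegral_tent_map_ne_zero hb hX hT y hr hr1) fun r hr hr1 => ?_
    have mt := (continuous_tent y r).measurable.coe_nnreal_ennreal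
    have mG : Measurable fun w : Set.Iic T → ℝ => (φ (U M m w) : ENNReal) :=
      (hφ.measurable.comp (measurable_U M m)).coe_nnreal_ennreal
    rw [← hQ.lintegral_eq mG mt, lintegral_map mt (hX.measurable_process T)]
    exact H φ hφ B hB hφ2 r hr hr1
  rcases (Nat.lt_succ_iff.1 m.2).lt_or_eq with hm | hm
  · obtain ⟨C₁, hC₁⟩ := hX.lintegral_mul_le hb hδ hm
    obtain ⟨ρ, C₂, mρ, hρ0, hρC, hρ⟩ := hX.le_lintegral_mul hb hδ (Nat.pos_of_ne_zero hM)
      (R := |y| + 1) (by positivity)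
    have hS := hX.lintegral_sq_lt_top hb (step T M) m
    set S := ∫⁻ ω, ENNReal.ofReal (X (m * step T M) ω ^ 2) ∂P
    set c := ∫⁻ ω, ρ ω ∂P with hc
    have hc0 : c ≠ 0 := by
      intro h
      rw [hc, lintegral_eq_zero_iff mρ] at h
      obtain ⟨ω, hω⟩ := h.exists
      exact hρ0 ω hω
    have hcT : c ≠ ⊤ := ((lintegral_mono hρC).trans_lt (by simp)).ne
    refine ⟨C₁ * c⁻¹ * S, ENNReal.mul_ne_top (ENNReal.mul_ne_top ENNReal.coe_ne_top
      (ENNReal.inv_ne_top.2 hc0)) hS.ne, fun φ hφ B hB hφ2 r hr hr1 => ?_⟩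
    have h1 := hC₁ φ (tent y r) hφ (continuous_tent y r) (max B 1)
      (fun x => (hB x).trans (le_max_left _ _))
      (fun x => (tent_le_one hr y x).trans (le_max_right _ _))
    have h2 := hρ (fun _ => 1) (tent y r) continuous_const (continuous_tent y r) 1
      (fun _ => le_rfl) (tent_le_one hr y) (fun x hx => tent_eq_zero_of_abs hr hr1 hx)
    simp only [ENNReal.coe_one, one_mul] at h2
    rw [hMT] at h1 h2
    have h3 : ∫⁻ x, (tent y r x : ENNReal) ≤ c⁻¹ * ∫⁻ ω, tent y r (X T ω) ∂P := by
      have := mul_le_mul_right h2 c⁻¹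
      rwa [← mul_assoc, ENNReal.inv_mul_cancel hc0 hcT, one_mul] at this
    have h4 : ∫⁻ ω, (φ (X (m * step T M) ω) : ENNReal) ∂P ≤ S := lintegral_mono fun ω => hφ2 _
    calc _ ≤ _ := h1
      _ ≤ C₁ * (c⁻¹ * ∫⁻ ω, tent y r (X T ω) ∂P) * S := by gcongr
      _ = _ := by ring
  · refine ⟨ENNReal.ofReal ((|y| + 1) ^ 2), ENNReal.ofReal_ne_top, fun φ hφ B hB hφ2 r hr hr1 => ?_⟩
    rw [hm, hMT, ← lintegral_const_mul' _ _ ENNReal.ofReal_ne_top]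
    refine lintegral_mono fun ω => ?_
    by_cases hx : |y| + 1 < |X T ω|
    · simp [tent_eq_zero_of_abs hr hr1 hx]
    · refine mul_le_mul_left ((hφ2 _).trans (ENNReal.ofReal_le_ofReal ?_)) _
      rw [← sq_abs]
      exact pow_le_pow_left₀ (abs_nonneg _) (not_lt.1 hx) 2

theorem IsBridgeKernel.memLp_two (hQ : IsBridgeKernel P X T Q) (hb : LipschitzWith K b)
    (hX : IsEulerLimit P b x₀ W X) (hT : 0 < T) {M : ℕ} (hM : M ≠ 0) (m : Fin (M + 1)) (y : ℝ) :
    MemLp (U M m) 2 (Q y) := by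
  obtain ⟨C, hC, h⟩ := hQ.exists_lintegral_le hb hX hT hM m y
  rw [memLp_two_iff_integrable_sq (measurable_U M m).aestronglyMeasurable]
  refine ⟨((measurable_U M m).pow_const 2).aestronglyMeasurable, ?_⟩
  rw [hasFiniteIntegral_iff_ofReal (ae_of_all _ fun w => sq_nonneg _)]
  have hlim : Filter.Tendsto (fun n : ℕ => ∫⁻ w, (min (U M m w ^ 2).toNNReal n : ℝ≥0) ∂(Q y))
      Filter.atTop (nhds (∫⁻ w, ENNReal.ofReal (U M m w ^ 2) ∂(Q y))) := by
    refine lintegral_tendsto_of_tendsto_of_monotone (fun n => ?_) (ae_of_all _ fun w => ?_)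
      (ae_of_all _ fun w => ?_)
    · exact (((measurable_U M m).pow_const 2).real_toNNReal.min
        measurable_const).coe_nnreal_ennreal.aemeasurable
    · intro i j hij
      have hij' : (i : ℝ≥0) ≤ j := by exact_mod_cast hij
      exact ENNReal.coe_le_coe.2 (min_le_min_left _ hij')
    · refine tendsto_const_nhds.congr' ?_
      obtain ⟨n₀, hn₀⟩ := exists_nat_ge (U M m w ^ 2).toNNReal
      filter_upwards [Filter.eventually_ge_atTop n₀] with n hn
      have hn' : (n₀ : ℝ≥0) ≤ n := by exact_mod_cast hn
      rw [min_eq_left (hn₀.trans hn')]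
      rfl
  refine (le_of_tendsto' hlim fun n => ?_).trans_lt hC.lt_top
  exact h (fun x => min (x ^ 2).toNNReal n) (by fun_prop) n (fun x => min_le_right _ _)
    fun x => ENNReal.coe_le_coe.2 (min_le_left _ _)

/-- At interior times, the law of the bridge charges all nonempty open sets. -/
theorem IsBridgeKernel.lintegral_ne_zero (hQ : IsBridgeKernel P X T Q) (hb : LipschitzWith K b)
    (hX : IsEulerLimit P b x₀ W X) (hT : 0 < T) {M : ℕ} (m : Fin (M + 1)) (hm0 : 0 < (m : ℕ))
    (hmM : (m : ℕ) < M) (y : ℝ) {φ : ℝ → ℝ≥0} (hφ : Continuous φ) (hφ1 : ∀ x, φ x ≤ 1)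
    {R : ℝ} (hR0 : 0 ≤ R) (hR : ∀ x, R < |x| → φ x = 0) {z : ℝ} (hz : φ z ≠ 0) :
    ∫⁻ w, φ (U M m w) ∂(Q y) ≠ 0 := by
  have hP := hX.brownian.isGaussianProcess.isProbabilityMeasure
  have := Measure.isProbabilityMeasure_map (μ := P) hQ.condDistrib.aemeasurable_fst
  have hM : M ≠ 0 := by omega
  have hδ := step_ne_zero hT hM
  have hMT := mul_step_self T hM
  obtain ⟨C₁, hC₁⟩ := hX.lintegral_mul_le hb hδ (Nat.pos_of_ne_zero hM)
  obtain ⟨ρ, C₂, mρ, hρ0, hρC, hρ⟩ := hX.le_lintegral_mul hb hδ hmM (R := |y| + 1) (by positivity)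
  set c := ∫⁻ ω, φ (X (m * step T M) ω) * ρ ω ∂P with hc
  have mφ : Measurable fun ω => (φ (X (m * step T M) ω) : ENNReal) :=
    (hφ.measurable.comp (hX.measurable_process _)).coe_nnreal_ennreal
  have hc0 : c ≠ 0 := by
    intro h
    have mφρ := mφ.mul mρ
    simp only [Pi.mul_def] at mφρ
    rw [hc, lintegral_eq_zero_iff mφρ] at h
    refine hX.lintegral_ne_zero hb hδ hm0 hφ hφ1 hR0 hR hz ?_
    rw [lintegral_eq_zero_iff mφ]
    filter_upwards [h] with ω hω
    exact (mul_eq_zero.1 hω).resolve_right (hρ0 ω)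
  have hlow : c * ((C₁ + 1 : ℝ≥0) : ENNReal)⁻¹ ≤ ∫⁻ w, φ (U M m w) ∂(Q y) := by
    refine le_of_le_lintegral_tent (μ := P.map (X T)) (hQ.continuous_lintegral M m hφ hφ1)
      (fun r hr hr1 => lintegral_tent_map_ne_zero hb hX hT y hr hr1) fun r hr hr1 => ?_
    have mt := (continuous_tent y r).measurable.coe_nnreal_ennreal
    have mG : Measurable fun w : Set.Iic T → ℝ => (φ (U M m w) : ENNReal) :=
      (hφ.measurable.comp (measurable_U M m)).coe_nnreal_ennreal
    rw [← hQ.lintegral_eq mG mt, lintegral_map mt (hX.measurable_process T)]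
    have h1 := hC₁ (fun _ => 1) (tent y r) continuous_const (continuous_tent y r) 1
      (fun _ => le_rfl) (tent_le_one hr y)
    have h2 := hρ φ (tent y r) hφ (continuous_tent y r) 1 hφ1 (tent_le_one hr y)
      (fun x hx => tent_eq_zero_of_abs hr hr1 hx)
    simp only [ENNReal.coe_one, one_mul, lintegral_const, measure_univ, mul_one] at h1
    rw [hMT] at h1 h2
    have h3 : ((C₁ + 1 : ℝ≥0) : ENNReal)⁻¹ * ∫⁻ ω, tent y r (X T ω) ∂P
        ≤ ∫⁻ x, (tent y r x : ENNReal) := by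
      rw [ENNReal.inv_mul_le_iff (by simp) ENNReal.coe_ne_top]
      refine h1.trans (mul_le_mul_left ?_ _)
      exact_mod_cast le_self_add
    rw [mul_assoc]
    exact (mul_le_mul_right h3 c).trans h2
  intro h
  rw [h, nonpos_iff_eq_zero, mul_eq_zero] at hlow
  exact hlow.elim hc0 (ENNReal.inv_ne_zero.2 ENNReal.coe_ne_top)

/-- A continuous function that vanishes almost surely at an interior state of the bridge vanishes
identically. -/
theorem IsBridgeKernel.eq_zero_of_ae_eq_zero (hQ : IsBridgeKernel P X T Q)
    (hb : LipschitzWith K b) (hX : IsEulerLimit P b x₀ W X) (hT : 0 < T) {M : ℕ} (m : Fin (M + 1))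
    (hm0 : 0 < (m : ℕ)) (hmM : (m : ℕ) < M) (y : ℝ) {ψ : ℝ → ℝ} (hψ : Continuous ψ)
    (h : ∀ᵐ w ∂(Q y), ψ (U M m w) = 0) : ψ = 0 := by
  by_contra hne
  obtain ⟨z, hz⟩ := Function.ne_iff.1 hne
  refine hQ.lintegral_ne_zero hb hX hT m hm0 hmM y (z := z)
    (φ := fun x => min |ψ x|.toNNReal (tent z 1 x))
    ((continuous_real_toNNReal.comp hψ.abs).min (continuous_tent z 1))
    (fun x => (min_le_right _ _).trans (tent_le_one one_pos z x)) (R := |z| + 1) (by positivity)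
    (fun x hx => by simp [tent_eq_zero_of_abs one_pos le_rfl hx]) ?_ ?_
  · have : 0 < |ψ z| := abs_pos.2 hz
    simp only [tent_self]
    exact (lt_min (Real.toNNReal_pos.2 this) one_pos).ne'
  · rw [lintegral_congr_ae (g := fun _ => 0)]
    · simp
    · filter_upwards [h] with w hw
      simp [hw]

end Bridge

/-! ### Maximisation of a concave quadratic function -/

section Quadratic

variable {n : Type*} [Fintype n] {A : Matrix n n ℝ}

/-- Completing the square around a solution `θ₁` of `A θ₁ = v`. -/
theorem quadratic_eq_of_mulVec_eq (hA : A.PosDef) {v θ₁ : n → ℝ} (h₁ : A.mulVec θ₁ = v)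
    (θ : n → ℝ) : θ ⬝ᵥ v - 1 / 2 * (θ ⬝ᵥ A.mulVec θ) =
      θ₁ ⬝ᵥ v - 1 / 2 * (θ₁ ⬝ᵥ A.mulVec θ₁) - 1 / 2 * ((θ - θ₁) ⬝ᵥ A.mulVec (θ - θ₁)) := by
  have hsymm : θ₁ ⬝ᵥ A.mulVec θ = θ ⬝ᵥ A.mulVec θ₁ := by
    have hT : A.transpose = A := by simpa using hA.isHermitian.eq
    rw [Matrix.dotProduct_mulVec, ← Matrix.mulVec_transpose, hT, dotProduct_comm]
  rw [← h₁, Matrix.mulVec_sub, sub_dotProduct, dotProduct_sub, dotProduct_sub, hsymm]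
  ring

theorem quadratic_max_iff [DecidableEq n] (hA : A.PosDef) {v : n → ℝ} {L : (n → ℝ) → ℝ} {c : ℝ}
    (hL : ∀ θ, L θ = c + θ ⬝ᵥ v - 1 / 2 * (θ ⬝ᵥ A.mulVec θ)) (θ : n → ℝ) :
    (∀ θ', L θ' ≤ L θ) ↔ A.mulVec θ = v := by
  have hpos : ∀ x : n → ℝ, x ≠ 0 → 0 < x ⬝ᵥ A.mulVec x := fun x hx => by
    simpa using hA.dotProduct_mulVec_pos hx
  constructor
  · intro h
    have hdet : IsUnit A.det := (Matrix.isUnit_iff_isUnit_det A).1 hA.isUnit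
    have h₁ : A.mulVec (A⁻¹.mulVec v) = v := by
      rw [Matrix.mulVec_mulVec, Matrix.mul_nonsing_inv A hdet, Matrix.one_mulVec]
    have h2 := quadratic_eq_of_mulVec_eq hA h₁ θ
    have h3 := h (A⁻¹.mulVec v)
    rw [hL, hL] at h3
    by_cases hθ : θ - A⁻¹.mulVec v = 0
    · rw [sub_eq_zero.1 hθ, h₁]
    · linarith [hpos _ hθ]
  · intro h θ'
    have h2 := quadratic_eq_of_mulVec_eq hA h θ'
    have h3 : 0 ≤ (θ' - θ) ⬝ᵥ A.mulVec (θ' - θ) := by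
      by_cases hθ : θ' - θ = 0
      · simp [hθ]
      · exact (hpos _ hθ).le
    rw [hL, hL]
    linarith

theorem exists_quadraticForm [DecidableEq n] (hA : A.PosDef) {v : n → ℝ} {L : (n → ℝ) → ℝ} {c : ℝ}
    (hL : ∀ θ, L θ = c + θ ⬝ᵥ v - 1 / 2 * (θ ⬝ᵥ A.mulVec θ)) :
    ∃ (q : QuadraticForm ℝ (n → ℝ)) (l : (n → ℝ) →ₗ[ℝ] ℝ) (c : ℝ),
      (QuadraticMap.polarBilin q).Nondegenerate ∧ ∀ θ, L θ = q θ + l θ + c := by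
  set q : QuadraticForm ℝ (n → ℝ) := (-(1 / 2 : ℝ)) • A.toQuadraticForm' with hq
  have hqv : ∀ θ, q θ = -(1 / 2 : ℝ) * (θ ⬝ᵥ A.mulVec θ) := fun θ => by
    simp [hq, Matrix.toQuadraticForm', Matrix.toLinearMap₂'_apply']
  have hself : ∀ x, QuadraticMap.polarBilin q x x = -(x ⬝ᵥ A.mulVec x) := fun x => by
    simp only [QuadraticMap.polarBilin_apply_apply, QuadraticMap.polar, hqv, Matrix.mulVec_add,
      add_dotProduct, dotProduct_add]
    ring
  have hzero : ∀ x, QuadraticMap.polarBilin q x x = 0 → x = 0 := fun x hx => by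
    by_contra hne
    have := hA.dotProduct_mulVec_pos hne
    simp only [star_trivial] at this
    rw [hself] at hx
    linarith
  refine ⟨q, Fintype.linearCombination ℝ v, c, ⟨fun x hx => hzero x (hx x),
    fun x hx => hzero x (hx x)⟩, fun θ => ?_⟩
  rw [hL, hqv, Fintype.linearCombination_apply]
  simp only [smul_eq_mul, dotProduct]
  ring

end Quadratic

/-! ### The expected log-likelihood -/

theorem exists_lipschitzWith_drift {N : ℕ} {g : ℝ → ℝ} {f : Fin (N + 1) → ℝ → ℝ}
    (hg : ∃ K : ℝ≥0, LipschitzWith K g) (hf : ∀ i, ∃ K : ℝ≥0, LipschitzWith K (f i))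
    (θ : Fin (N + 1) → ℝ) : ∃ K : ℝ≥0, LipschitzWith K fun x => drift g f x θ := by
  obtain ⟨Kg, hg⟩ := hg
  have hsum : ∀ s : Finset (Fin (N + 1)), ∃ K : ℝ≥0,
      LipschitzWith K fun x => ∑ i ∈ s, θ i * f i x := by
    intro s
    induction s using Finset.induction_on with
    | empty => exact ⟨0, by simp⟩
    | insert i s hi ih =>
      obtain ⟨K, hK⟩ := ih
      obtain ⟨Ki, hKi⟩ := hf i
      simp only [Finset.sum_insert hi]
      exact ⟨_, ((lipschitzWith_smul (θ i)).comp hKi).add hK⟩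
  obtain ⟨K, hK⟩ := hsum Finset.univ
  exact ⟨_, hg.add hK⟩

theorem memLp_two_comp_lipschitz {α : Type*} [MeasurableSpace α] {ν : Measure α}
    [IsFiniteMeasure ν] {V : α → ℝ} (hV : MemLp V 2 ν) {u : ℝ → ℝ}
    (hu : ∃ K : ℝ≥0, LipschitzWith K u) : MemLp (fun w => u (V w)) 2 ν := by
  obtain ⟨K, hK⟩ := hu
  refine ((memLp_const |u 0|).add (hV.norm.const_mul (K : ℝ))).mono
    (hK.continuous.comp_aestronglyMeasurable hV.1) (ae_of_all _ fun w => ?_)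
  have h1 := abs_sub_le_of_lipschitz hK (V w) 0
  have h2 := abs_sub_abs_le_abs_sub (u (V w)) (u 0)
  rw [sub_zero] at h1
  simp only [Pi.add_apply, Real.norm_eq_abs]
  exact le_trans (by linarith) (le_abs_self _)

theorem log_gaussianPDFReal {v : ℝ≥0} (hv : v ≠ 0) (m x : ℝ) :
    Real.log (gaussianPDFReal m v x) =
      Real.log (√(2 * Real.pi * v))⁻¹ - (x - m) ^ 2 / (2 * v) := by
  have hv' : (0 : ℝ) < v := by positivity
  rw [gaussianPDFReal, Real.log_mul (by positivity) (Real.exp_pos _).ne', Real.log_exp]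
  ring

section Likelihood

variable {N : ℕ} {g : ℝ → ℝ} {f : Fin (N + 1) → ℝ → ℝ} {T : ℝ≥0} {M : ℕ}
  {ν : Measure (Set.Iic T → ℝ)}

/-- The log-likelihood of one step, expanded in powers of the parameter. -/
theorem log_gaussianPDFReal_step (hδ : step T M ≠ 0) (θ : Fin (N + 1) → ℝ) (m : Fin M)
    (w : Set.Iic T → ℝ) :
    Real.log (gaussianPDFReal
      (U M m.castSucc w + step T M * drift g f (U M m.castSucc w) θ) (step T M) (U M m.succ w)) =
    (Real.log (√(2 * Real.pi * step T M))⁻¹ -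
      (U M m.succ w - U M m.castSucc w - g (U M m.castSucc w) * step T M) ^ 2 / (2 * step T M))
    + (∑ j, θ j * ((U M m.succ w - U M m.castSucc w - g (U M m.castSucc w) * step T M) *
        f j (U M m.castSucc w)))
    - 1 / 2 * (∑ j, ∑ i, θ j * θ i * (step T M *
        (f i (U M m.castSucc w) * f j (U M m.castSucc w)))) := by
  have hδ' : (step T M : ℝ) ≠ 0 := by exact_mod_cast hδ
  rw [log_gaussianPDFReal hδ]
  set D := U M m.succ w - U M m.castSucc w - g (U M m.castSucc w) * step T M with hD
  set S := ∑ i, θ i * f i (U M m.castSucc w) with hS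
  have e1 : ∑ j, θ j * (D * f j (U M m.castSucc w)) = D * S := by
    rw [hS, Finset.mul_sum]
    exact Finset.sum_congr rfl fun j _ => by ring
  have e2 : ∑ j, ∑ i, θ j * θ i * (step T M *
      (f i (U M m.castSucc w) * f j (U M m.castSucc w))) = step T M * (S * S) := by
    rw [hS, Finset.sum_mul_sum, Finset.mul_sum]
    refine Finset.sum_congr rfl fun j _ => ?_
    rw [Finset.mul_sum]
    exact Finset.sum_congr rfl fun i _ => by ring
  have e3 : U M m.succ w - (U M m.castSucc w + step T M * drift g f (U M m.castSucc w) θ)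
      = D - step T M * S := by
    rw [hD, drift, hS]; ring
  rw [e1, e2, e3]
  field_simp
  ring

theorem integrable_mul_f [IsFiniteMeasure ν] (hf : ∀ i, ∃ K : ℝ≥0, LipschitzWith K (f i))
    (hU : ∀ m, MemLp (U M m) 2 ν) (m : Fin M) (i j : Fin (N + 1)) :
    Integrable (fun w => f i (U M m.castSucc w) * f j (U M m.castSucc w)) ν :=
  (memLp_two_comp_lipschitz (hU _) (hf i)).integrable_mul (memLp_two_comp_lipschitz (hU _) (hf j))

theorem memLp_two_residual [IsFiniteMeasure ν] (hg : ∃ K : ℝ≥0, LipschitzWith K g)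
    (hU : ∀ m, MemLp (U M m) 2 ν) (m : Fin M) :
    MemLp (fun w => U M m.succ w - U M m.castSucc w - g (U M m.castSucc w) * step T M) 2 ν :=
  ((hU m.succ).sub (hU m.castSucc)).sub ((memLp_two_comp_lipschitz (hU _) hg).mul_const _)

theorem integrable_residual_mul_f [IsFiniteMeasure ν] (hg : ∃ K : ℝ≥0, LipschitzWith K g)
    (hf : ∀ i, ∃ K : ℝ≥0, LipschitzWith K (f i)) (hU : ∀ m, MemLp (U M m) 2 ν) (m : Fin M)
    (j : Fin (N + 1)) :
    Integrable (fun w => (U M m.succ w - U M m.castSucc w - g (U M m.castSucc w) * step T M) *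
      f j (U M m.castSucc w)) ν :=
  (memLp_two_residual hg hU m).integrable_mul (memLp_two_comp_lipschitz (hU _) (hf j))

/-- The expected log-likelihood of one step is a quadratic function of the parameter. -/
theorem integrable_and_integral_step [IsFiniteMeasure ν] (hδ : step T M ≠ 0)
    (hg : ∃ K : ℝ≥0, LipschitzWith K g) (hf : ∀ i, ∃ K : ℝ≥0, LipschitzWith K (f i))
    (hU : ∀ m, MemLp (U M m) 2 ν) (m : Fin M) (θ : Fin (N + 1) → ℝ) :
    Integrable (fun w => Real.log (gaussianPDFReal
      (U M m.castSucc w + step T M * drift g f (U M m.castSucc w) θ) (step T M)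
        (U M m.succ w))) ν ∧
    ∫ w, Real.log (gaussianPDFReal
      (U M m.castSucc w + step T M * drift g f (U M m.castSucc w) θ) (step T M)
        (U M m.succ w)) ∂ν =
      (∫ w, (Real.log (√(2 * Real.pi * step T M))⁻¹ -
        (U M m.succ w - U M m.castSucc w - g (U M m.castSucc w) * step T M) ^ 2 /
          (2 * step T M)) ∂ν)
      + θ ⬝ᵥ vecB g f M ν m
      - 1 / 2 * (θ ⬝ᵥ ((step T M : ℝ) • matA f M ν m).mulVec θ) := by
  simp only [log_gaussianPDFReal_step hδ θ m]
  have h1 : Integrable (fun w => Real.log (√(2 * Real.pi * step T M))⁻¹ -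
      (U M m.succ w - U M m.castSucc w - g (U M m.castSucc w) * step T M) ^ 2 /
        (2 * step T M)) ν :=
    (integrable_const _).sub ((memLp_two_residual hg hU m).integrable_sq.div_const _)
  have h2 : ∀ j, Integrable (fun w =>
      θ j * ((U M m.succ w - U M m.castSucc w - g (U M m.castSucc w) * step T M) *
        f j (U M m.castSucc w))) ν :=
    fun j => (integrable_residual_mul_f hg hf hU m j).const_mul _
  have h2' := integrable_finsetSum Finset.univ fun j _ => h2 j
  have h3 : ∀ j i, Integrable (fun w => θ j * θ i * ((step T M : ℝ) *
      (f i (U M m.castSucc w) * f j (U M m.castSucc w)))) ν :=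
    fun j i => ((integrable_mul_f hf hU m i j).const_mul _).const_mul _
  have h3' := fun j => integrable_finsetSum Finset.univ fun i _ => h3 j i
  have h3'' := (integrable_finsetSum Finset.univ fun j _ => h3' j).const_mul (1 / 2)
  have h12 := h1.add h2'
  simp only [Pi.add_def] at h12
  refine ⟨h12.sub h3'', ?_⟩
  rw [integral_sub h12 h3'', integral_add h1 h2', integral_const_mul,
    integral_finsetSum _ fun j _ => h2 j, integral_finsetSum _ fun j _ => h3' j]
  congr 2
  · congr 1
    simp only [vecB, integral_const_mul]
  · refine Finset.sum_congr rfl fun j _ => ?_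
    rw [integral_finsetSum _ fun i _ => h3 j i, Matrix.mulVec, dotProduct, Finset.mul_sum]
    refine Finset.sum_congr rfl fun i _ => ?_
    rw [integral_const_mul, integral_const_mul]
    simp only [Matrix.smul_apply, matA, Matrix.of_apply, smul_eq_mul]
    ring

theorem integrable_logLik [IsFiniteMeasure ν] (hδ : step T M ≠ 0)
    (hg : ∃ K : ℝ≥0, LipschitzWith K g) (hf : ∀ i, ∃ K : ℝ≥0, LipschitzWith K (f i))
    (hU : ∀ m, MemLp (U M m) 2 ν) (θ : Fin (N + 1) → ℝ) : Integrable (logLik g f M θ) ν :=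
  integrable_finsetSum _ fun m _ => (integrable_and_integral_step hδ hg hf hU m θ).1

theorem exists_completeLik_eq [IsFiniteMeasure ν] (hδ : step T M ≠ 0)
    (hg : ∃ K : ℝ≥0, LipschitzWith K g) (hf : ∀ i, ∃ K : ℝ≥0, LipschitzWith K (f i))
    (hU : ∀ m, MemLp (U M m) 2 ν) : ∃ c : ℝ, ∀ θ, completeLik g f M ν θ =
      c + θ ⬝ᵥ sysB g f M ν - 1 / 2 * (θ ⬝ᵥ (sysA f M ν).mulVec θ) := by
  refine ⟨∑ m : Fin M, ∫ w, (Real.log (√(2 * Real.pi * step T M))⁻¹ -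
    (U M m.succ w - U M m.castSucc w - g (U M m.castSucc w) * step T M) ^ 2 /
      (2 * step T M)) ∂ν, fun θ => ?_⟩
  have h := fun m => integrable_and_integral_step (f := f) hδ hg hf hU m θ
  simp only [completeLik, logLik]
  rw [integral_finsetSum _ fun m _ => (h m).1]
  simp only [(h _).2, Finset.sum_sub_distrib, Finset.sum_add_distrib, sysA, sysB]
  rw [dotProduct_sum, Finset.smul_sum, Matrix.sum_mulVec, dotProduct_sum, Finset.mul_sum]

theorem dotProduct_sysA_mulVec [IsFiniteMeasure ν] (hf : ∀ i, ∃ K : ℝ≥0, LipschitzWith K (f i))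
    (hU : ∀ m, MemLp (U M m) 2 ν) (v : Fin (N + 1) → ℝ) :
    v ⬝ᵥ (sysA f M ν).mulVec v =
      step T M * ∑ m : Fin M, ∫ w, (∑ i, v i * f i (U M m.castSucc w)) ^ 2 ∂ν := by
  have h3 : ∀ (m : Fin M) j i, Integrable (fun w => v j * v i *
      (f i (U M m.castSucc w) * f j (U M m.castSucc w))) ν :=
    fun m j i => (integrable_mul_f hf hU m i j).const_mul _
  have hm : ∀ m : Fin M, ∫ w, (∑ i, v i * f i (U M m.castSucc w)) ^ 2 ∂ν
      = v ⬝ᵥ (matA f M ν m).mulVec v := by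
    intro m
    have e : ∀ w : Set.Iic T → ℝ, (∑ i, v i * f i (U M m.castSucc w)) ^ 2 = ∑ j, ∑ i, v j * v i *
        (f i (U M m.castSucc w) * f j (U M m.castSucc w)) := fun w => by
      rw [sq, Finset.sum_mul_sum]
      exact Finset.sum_congr rfl fun j _ => Finset.sum_congr rfl fun i _ => by ring
    simp only [e]
    rw [integral_finsetSum _ fun j _ => integrable_finsetSum _ fun i _ => h3 m j i]
    refine Finset.sum_congr rfl fun j _ => ?_
    rw [integral_finsetSum _ fun i _ => h3 m j i, Matrix.mulVec, dotProduct, Finset.mul_sum]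
    refine Finset.sum_congr rfl fun i _ => ?_
    rw [integral_const_mul]
    simp only [matA, Matrix.of_apply]
    ring
  simp only [hm]
  rw [sysA, Matrix.smul_mulVec, dotProduct_smul, Matrix.sum_mulVec, dotProduct_sum, smul_eq_mul]

/-- `A` is positive definite as soon as no nontrivial linear combination of the `fᵢ` vanishes almost
surely at one of the states that precede the endpoint. -/
theorem posDef_sysA [IsFiniteMeasure ν] (hδ : step T M ≠ 0)
    (hf : ∀ i, ∃ K : ℝ≥0, LipschitzWith K (f i)) (hU : ∀ m, MemLp (U M m) 2 ν) (m : Fin M)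
    (hm : ∀ v : Fin (N + 1) → ℝ, (∀ᵐ w ∂ν, ∑ i, v i * f i (U M m.castSucc w) = 0) → v = 0) :
    (sysA f M ν).PosDef := by
  have hsymm : (sysA f M ν).IsHermitian := by
    ext i j
    simp [sysA, matA, Matrix.sum_apply, mul_comm]
  refine Matrix.PosDef.of_dotProduct_mulVec_pos hsymm fun v hv => ?_
  have hδ' : (0 : ℝ) < step T M := by positivity
  rw [star_trivial, dotProduct_sysA_mulVec hf hU]
  refine mul_pos hδ' (Finset.sum_pos' (fun m _ => integral_nonneg fun w => sq_nonneg _)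
    ⟨m, Finset.mem_univ _, ?_⟩)
  refine (integral_nonneg fun w => sq_nonneg _).lt_of_ne fun h0 => hv (hm v ?_)
  have hL : MemLp (fun w => ∑ i, v i * f i (U M m.castSucc w)) 2 ν :=
    memLp_finsetSum _ fun i _ => (memLp_two_comp_lipschitz (hU _) (hf i)).const_mul _
  filter_upwards [(integral_eq_zero_iff_of_nonneg (fun w => sq_nonneg _) hL.integrable_sq).1
    h0.symm] with w hw
  simpa using hw

end Likelihood

end DiffusionEM

theorem proposition2 {N : ℕ} (g : ℝ → ℝ) (f : Fin (N + 1) → ℝ → ℝ)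
    (hg : ∃ K : ℝ≥0, LipschitzWith K g) (hf : ∀ i, ∃ K : ℝ≥0, LipschitzWith K (f i))
    (hind : LinearIndependent ℝ f)
    (T : ℝ≥0) (hT : 0 < T) (M : ℕ) (hM : 2 ≤ M) (θ₀ : Fin (N + 1) → ℝ) (u₀ uM : ℝ)
    {Ω : Type*} [MeasurableSpace Ω] (P : Measure Ω) [IsProbabilityMeasure P]
    (X : ℝ≥0 → Ω → ℝ)
    (hX : DiffusionEM.IsDiffusion P (fun x => DiffusionEM.drift g f x θ₀) u₀ X)
    (Q : Kernel ℝ (Set.Iic T → ℝ)) (hQ : DiffusionEM.IsBridgeKernel P X T Q) :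
    -- all expectations that occur are finite
    (∀ θ : Fin (N + 1) → ℝ, Integrable (DiffusionEM.logLik g f M θ) (Q uM)) ∧
    (∀ (m : Fin M) (i j : Fin (N + 1)), Integrable (fun w =>
      f i (DiffusionEM.U M m.castSucc w) * f j (DiffusionEM.U M m.castSucc w)) (Q uM)) ∧
    (∀ (m : Fin M) (j : Fin (N + 1)), Integrable (fun w =>
      (DiffusionEM.U M m.succ w - DiffusionEM.U M m.castSucc w
        - g (DiffusionEM.U M m.castSucc w) * DiffusionEM.step T M)
        * f j (DiffusionEM.U M m.castSucc w)) (Q uM)) ∧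
    -- a quadratic function of `θ` whose homogeneous quadratic part is nondegenerate
    (∃ (q : QuadraticForm ℝ (Fin (N + 1) → ℝ)) (l : (Fin (N + 1) → ℝ) →ₗ[ℝ] ℝ) (c : ℝ),
      (QuadraticMap.polarBilin q).Nondegenerate ∧
      ∀ θ, DiffusionEM.completeLik g f M (Q uM) θ = q θ + l θ + c) ∧
    -- the global maximum exists and is unique
    (∃! θ : Fin (N + 1) → ℝ, ∀ θ' : Fin (N + 1) → ℝ,
      DiffusionEM.completeLik g f M (Q uM) θ' ≤ DiffusionEM.completeLik g f M (Q uM) θ) ∧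
    -- the maximiser is the unique solution of the linear system `A θ = b`
    IsUnit (DiffusionEM.sysA f M (Q uM)) ∧
    (∀ θ : Fin (N + 1) → ℝ,
      (∀ θ' : Fin (N + 1) → ℝ,
        DiffusionEM.completeLik g f M (Q uM) θ' ≤ DiffusionEM.completeLik g f M (Q uM) θ) ↔
      (DiffusionEM.sysA f M (Q uM)).mulVec θ = DiffusionEM.sysB g f M (Q uM)) := by
  obtain ⟨K, hb⟩ := DiffusionEM.exists_lipschitzWith_drift hg hf θ₀
  obtain ⟨W, hlim⟩ := hX.exists_isEulerLimit hb
  have hM0 : M ≠ 0 := by omega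
  have hδ := DiffusionEM.step_ne_zero hT hM0
  have hmarkov := hQ.isMarkov
  have hU : ∀ m, MemLp (DiffusionEM.U M m) 2 (Q uM) := fun m => hQ.memLp_two hb hlim hT hM0 m uM
  have hA : (DiffusionEM.sysA f M (Q uM)).PosDef := by
    -- The state `U₁` is at an interior time because `M ≥ 2`; `U₀ = u₀` would not separate the `fᵢ`.
    refine DiffusionEM.posDef_sysA hδ hf hU ⟨1, by omega⟩ fun v hv => ?_
    have hcont : Continuous fun x => ∑ i, v i * f i x :=
      continuous_finsetSum _ fun i _ => ((hf i).choose_spec.continuous).const_mul _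
    have h0 := hQ.eq_zero_of_ae_eq_zero hb hlim hT (Fin.castSucc ⟨1, by omega⟩) (by simp)
      (by simp; omega) uM hcont hv
    refine funext (Fintype.linearIndependent_iff.1 hind v ?_)
    rw [← h0]
    ext x
    simp
  obtain ⟨c, hc⟩ := DiffusionEM.exists_completeLik_eq hδ hg hf hU
  have hmax := DiffusionEM.quadratic_max_iff hA hc
  refine ⟨DiffusionEM.integrable_logLik hδ hg hf hU, DiffusionEM.integrable_mul_f hf hU,
    DiffusionEM.integrable_residual_mul_f hg hf hU, DiffusionEM.exists_quadraticForm hA hc, ?_,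
    hA.isUnit, hmax⟩
  have hinj := Matrix.mulVec_injective_of_isUnit hA.isUnit
  obtain ⟨θ, hθ⟩ := Matrix.mulVec_surjective_iff_isUnit.2 hA.isUnit
    (DiffusionEM.sysB g f M (Q uM))
  exact ⟨θ, (hmax θ).2 hθ, fun θ' hθ' => hinj (((hmax θ').1 hθ').trans hθ.symm)⟩
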